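/- An alphabet is a finite nonempty set, and polynomials have coefficients in $\mathbb{N}$. A family of promise decision problems is a sequence $\{(L_n^{(+)},L_n^{(-)})\}_{n\in\mathbb{N}}$ of pairs of disjoint sets $L_n^{(+)},L_n^{(-)}\subseteq\Sigma^*$ over one alphabet $\Sigma$ that does not depend on $n$. Let $2\mathrm{D}$ (resp. $2\mathrm{N}$) be the class of all such families, over all alphabets, for which there are a polynomial $p$ and two-way deterministic (resp. nondeterministic) finite automata $M_n$ ($n\in\mathbb{N}$), working on $x$ written between two endmarkers, such that for every $n$ the automaton $M_n$ has at most $p(n)$ states, accepts every $x\in L_n^{(+)}$ and rejects every $x\in L_n^{(-)}$; its behaviour on other inputs is arbitrary. Here a deterministic automaton accepts (rejects) $x$ if its computation reaches an accepting (rejecting) state, and a nondeterministic one accepts $x$ if some computation path reaches an accepting state and rejects $x$ if none does. Let $2\mathrm{N}/\mathrm{poly}$ be the class of all families in $2\mathrm{N}$ for which there is a polynomial $r$ with $|x|\le r(n)$ for all $n$ and all $x\in L_n^{(+)}\cup L_n^{(-)}$. Let $\mathrm{NL}$ be the class of all languages, over all alphabets, accepted by nondeterministic Turing machines with a read-only input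 tape and a work tape on which, on all inputs $x$ and along all computation paths, only cells of index at most $c\log|x|+d$ are visited, for constants $c,d\ge 0$ (with $\log 0=0$). Let $\mathrm{L}/\mathrm{poly}$ be the class of all languages $L$ for which there are an advice alphabet $\Theta$, a polynomial $p$, a function $h:\mathbb{N}\to\Theta^*$ with $|h(n)|\le p(n)$ for all $n$, and a deterministic Turing machine with a read-only input tape, a read-only advice tape and a work tape that, on every input $x$ with $h(|x|)$ on its advice tape, visits only work tape cells of index at most $c\log|x|+d$ for constants $c,d\ge 0$, and halts accepting if $x\in L$ and halts rejecting if $x\notin L$. Then \[ 2\mathrm{N}/\mathrm{poly}\subseteq 2\mathrm{D}\quad\Longleftrightarrow\quad \mathrm{NL}\subseteq\mathrm{L}/\mathrm{poly}. \] -/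

import Mathlib

namespace StateComplexity

/-! ### Tapes -/

/-- The tape alphabet of a read-only tape: the letters and the two endmarkers. -/
inductive Marked (A : Type) : Type where
  | lend : Marked A
  | letter (a : A) : Marked A
  | rend : Marked A

/-- The tape holding the string `x` between the two endmarkers. -/
def markedTape {A : Type} (x : List A) : List (Marked A) :=
  Marked.lend :: (x.map Marked.letter ++ [Marked.rend])

theorem length_markedTape {A : Type} (x : List A) : (markedTape x).length = x.length + 2 := by
  simp [markedTape]

/-- The symbol in cell `i` of the tape holding `x`. Cell `0` holds the left endmarker and cell
`x.length + 1` the right endmarker. -/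
def readCell {A : Type} (x : List A) (i : Fin (x.length + 2)) : Marked A :=
  (markedTape x).get (i.cast (length_markedTape x).symm)

/-- Head moves: one cell to the left, stationary, one cell to the right. -/
inductive Dir : Type where
  | left : Dir
  | stay : Dir
  | right : Dir

/-- Head moves on a circular read-only tape: positions are taken modulo the number of cells. -/
def Dir.moveCirc {n : ℕ} : Dir → Fin (n + 2) → Fin (n + 2)
  | Dir.left, i => i - 1
  | Dir.stay, i => i
  | Dir.right, i => i + 1

/-- Head moves on a work tape with cells `0, 1, 2, …`; a left move in cell `0` has no effect. -/
def Dir.moveWork : Dir → ℕ → ℕ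
  | Dir.left, i => i - 1
  | Dir.stay, i => i
  | Dir.right, i => i + 1

/-! ### Two-way finite automata -/

/-- Two-way nondeterministic finite automata over the input alphabet `A`. -/
structure TwoNFA (A : Type) : Type 1 where
  State : Type
  finite_state : Finite State
  start : State
  acc : Set State
  rej : Set State
  disjoint_halt : Disjoint acc rej
  trans : State → Marked A → Set (State × Dir)

/-- Configurations of a two-way finite automaton with state set `Q` on the input `x`. -/
structure TwoConf {A : Type} (Q : Type) (x : List A) : Type where
  state : Q
  pos : Fin (x.length + 2)

namespace TwoNFA

variable {A : Type} (M : TwoNFA A)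

def init (x : List A) : TwoConf M.State x := ⟨M.start, 0⟩

/-- One computation step; there is none from a halting state. -/
def Step (x : List A) (c c' : TwoConf M.State x) : Prop :=
  c.state ∉ M.acc ∪ M.rej ∧
    ∃ m ∈ M.trans c.state (readCell x c.pos), c' = ⟨m.1, m.2.moveCirc c.pos⟩

/-- Some computation path on `x` is accepting. -/
def Accepts (x : List A) : Prop :=
  ∃ c, Relation.ReflTransGen (M.Step x) (M.init x) c ∧ c.state ∈ M.acc

/-- No computation path on `x` is accepting. -/
def Rejects (x : List A) : Prop := ¬ M.Accepts x

end TwoNFA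

/-- Two-way deterministic finite automata over the input alphabet `A`. -/
structure TwoDFA (A : Type) : Type 1 where
  State : Type
  finite_state : Finite State
  start : State
  acc : Set State
  rej : Set State
  disjoint_halt : Disjoint acc rej
  trans : State → Marked A → State × Dir

namespace TwoDFA

variable {A : Type} (M : TwoDFA A)

def init (x : List A) : TwoConf M.State x := ⟨M.start, 0⟩

open Classical in
/-- One computation step; a configuration with a halting state does not change any more. -/
noncomputable def step (x : List A) (c : TwoConf M.State x) : TwoConf M.State x :=
  if c.state ∈ M.acc ∪ M.rej then c
  else
    let m := M.trans c.state (readCell x c.pos)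
    ⟨m.1, m.2.moveCirc c.pos⟩

/-- The computation on `x` reaches an accepting state. -/
def Accepts (x : List A) : Prop := ∃ t : ℕ, ((M.step x)^[t] (M.init x)).state ∈ M.acc

/-- The computation on `x` reaches a rejecting state. -/
def Rejects (x : List A) : Prop := ∃ t : ℕ, ((M.step x)^[t] (M.init x)).state ∈ M.rej

end TwoDFA

/-! ### Families of promise decision problems and nonuniform state complexity classes -/

/-- Families of promise decision problems over one fixed alphabet. -/
structure PromiseFamily : Type 1 where
  Alph : Type
  finite_alph : Finite Alph
  nonempty_alph : Nonempty Alph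
  pos : ℕ → Set (List Alph)
  neg : ℕ → Set (List Alph)
  disjoint_pos_neg : ∀ n, Disjoint (pos n) (neg n)

/-- A polynomial bound on the length of the promised inputs. -/
def PromiseFamily.HasPolyCeiling (F : PromiseFamily) : Prop :=
  ∃ r : Polynomial ℕ, ∀ n, ∀ x ∈ F.pos n ∪ F.neg n, x.length ≤ r.eval n

/-- The class `2N`. -/
def TwoN : Set PromiseFamily :=
  {F | ∃ (p : Polynomial ℕ) (M : ℕ → TwoNFA F.Alph), ∀ n,
    Nat.card (M n).State ≤ p.eval n ∧
    (∀ x ∈ F.pos n, (M n).Accepts x) ∧ (∀ x ∈ F.neg n, (M n).Rejects x)}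

/-- The class `2D`. -/
def TwoD : Set PromiseFamily :=
  {F | ∃ (p : Polynomial ℕ) (M : ℕ → TwoDFA F.Alph), ∀ n,
    Nat.card (M n).State ≤ p.eval n ∧
    (∀ x ∈ F.pos n, (M n).Accepts x) ∧ (∀ x ∈ F.neg n, (M n).Rejects x)}

/-- The class `2N/poly`. -/
def TwoNPoly : Set PromiseFamily := {F | F ∈ TwoN ∧ F.HasPolyCeiling}

/-! ### Turing machines -/

/-- Nondeterministic Turing machines with a read-only input tape over the alphabet `A` and one
rewritable work tape. A transition gives the next state, the move of the input head, the symbol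
written on the work tape and the move of the work head. -/
structure NTM (A : Type) : Type 1 where
  State : Type
  finite_state : Finite State
  Work : Type
  finite_work : Finite Work
  blank : Work
  start : State
  acc : Set State
  rej : Set State
  disjoint_halt : Disjoint acc rej
  trans : State → Marked A → Work → Set (State × Dir × Work × Dir)

namespace NTM

variable {A : Type} (M : NTM A)

structure Conf (x : List A) : Type where
  state : M.State
  inPos : Fin (x.length + 2)
  workPos : ℕ
  work : ℕ → M.Work

def init (x : List A) : M.Conf x := ⟨M.start, 0, 0, fun _ => M.blank⟩

/-- One computation step; there is none from a halting state. -/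
def Step (x : List A) (c c' : M.Conf x) : Prop :=
  c.state ∉ M.acc ∪ M.rej ∧
    ∃ m ∈ M.trans c.state (readCell x c.inPos) (c.work c.workPos),
      c' = ⟨m.1, m.2.1.moveCirc c.inPos, m.2.2.2.moveWork c.workPos,
        Function.update c.work c.workPos m.2.2.1⟩

/-- The configurations that occur on the computation paths on `x`. -/
def Reachable (x : List A) (c : M.Conf x) : Prop :=
  Relation.ReflTransGen (M.Step x) (M.init x) c

/-- Some computation path on `x` is accepting. -/
def Accepts (x : List A) : Prop := ∃ c, M.Reachable x c ∧ c.state ∈ M.acc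

/-- On every input and every computation path, the work head visits only cells whose index is
at most logarithmic in the input length. -/
def LogSpace : Prop :=
  ∃ a b : ℕ, ∀ (x : List A) (c : M.Conf x), M.Reachable x c →
    c.workPos ≤ a * Nat.log 2 x.length + b

end NTM

/-- Deterministic Turing machines with a read-only input tape over the alphabet `A`, a read-only
advice tape over the alphabet `B` and one rewritable work tape. A transition gives the next state,
the moves of the input head and of the advice head, the symbol written on the work tape and the
move of the work head. -/
structure AdvisedDTM (A B : Type) : Type 1 where
  State : Type
  finite_state : Finite State
  Work : Type
  finite_work : Finite Work
  blank : Work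
  start : State
  acc : Set State
  rej : Set State
  disjoint_halt : Disjoint acc rej
  trans : State → Marked A → Marked B → Work → State × Dir × Dir × Work × Dir

namespace AdvisedDTM

variable {A B : Type} (M : AdvisedDTM A B)

structure Conf (x : List A) (w : List B) : Type where
  state : M.State
  inPos : Fin (x.length + 2)
  advPos : Fin (w.length + 2)
  workPos : ℕ
  work : ℕ → M.Work

def init (x : List A) (w : List B) : M.Conf x w := ⟨M.start, 0, 0, 0, fun _ => M.blank⟩

open Classical in
/-- One computation step; a configuration with a halting state does not change any more. -/
noncomputable def step (x : List A) (w : List B) (c : M.Conf x w) : M.Conf x w :=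
  if c.state ∈ M.acc ∪ M.rej then c
  else
    let m := M.trans c.state (readCell x c.inPos) (readCell w c.advPos) (c.work c.workPos)
    ⟨m.1, m.2.1.moveCirc c.inPos, m.2.2.1.moveCirc c.advPos, m.2.2.2.2.moveWork c.workPos,
      Function.update c.work c.workPos m.2.2.2.1⟩

/-- The configuration after `t` steps on the input `x` with the advice string `w`. -/
noncomputable def run (x : List A) (w : List B) (t : ℕ) : M.Conf x w :=
  (M.step x w)^[t] (M.init x w)

def Accepts (x : List A) (w : List B) : Prop := ∃ t : ℕ, (M.run x w t).state ∈ M.acc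

def Rejects (x : List A) (w : List B) : Prop := ∃ t : ℕ, (M.run x w t).state ∈ M.rej

/-- With the advice function `h`, the work head visits only cells whose index is at most
logarithmic in the input length. -/
def LogSpaceWith (h : ℕ → List B) : Prop :=
  ∃ a b : ℕ, ∀ (x : List A) (t : ℕ),
    (M.run x (h x.length) t).workPos ≤ a * Nat.log 2 x.length + b

end AdvisedDTM

/-! ### Space complexity classes -/

/-- Decision problems, that is, languages together with their alphabet. -/
structure DecisionProblem : Type 1 where
  Alph : Type
  finite_alph : Finite Alph
  nonempty_alph : Nonempty Alph
  yes : Set (List Alph)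

/-- The class `NL`. -/
def NL : Set DecisionProblem :=
  {P | ∃ M : NTM P.Alph, M.LogSpace ∧ ∀ x, x ∈ P.yes ↔ M.Accepts x}

/-- The class `L/poly`. -/
def LPoly : Set DecisionProblem :=
  {P | ∃ (B : Type) (_ : Finite B) (_ : Nonempty B) (M : AdvisedDTM P.Alph B)
      (h : ℕ → List B) (p : Polynomial ℕ),
    (∀ n, (h n).length ≤ p.eval n) ∧ M.LogSpaceWith h ∧
    (∀ x ∈ P.yes, M.Accepts x (h x.length)) ∧ (∀ x ∉ P.yes, M.Rejects x (h x.length))}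

end StateComplexity

namespace StateComplexity

/-! ### Finiteness of tape symbols and head moves -/

/-! Logarithmic work space on inputs of length `n` and polynomially many states are interchangeable:
a work tape of `O(log n)` cells has polynomially many contents, and a state of a polynomial-size
automaton has a binary label of `O(log n)` bits.

Suppose `2N/poly ⊆ 2D` and cut a language in `NL` into slices by input length. Each slice is solved
by a two-way nondeterministic automaton whose states contain the work tape (`NTM.toTwoNFA`), so the
slices form a family in `2N/poly` and have small deterministic automata. These automata, written out
as lists of instructions, serve as advice for one fixed interpreter that stores only the label of
the current state (`interp.correct`).

Conversely, acceptance by a two-way nondeterministic automaton is reachability in its configuration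
graph, which has polynomially many vertices because the ceiling bounds the input length. One fixed
machine `universal` decides reachability in graphs listed edge by edge. `NTM.clocked` confines it to
logarithmic space on every input, also on strings that list no graph, so the resulting language is
in `NL` and hence in `L/poly`. The list for an input `x` is never stored: its length does not depend
on `x`, so a single advice string serves all promised inputs of index `n`, and each of its letters
depends only on the length of `x` and one cell of `x` (`TwoNFA.exists_template`). A deterministic
two-way automaton with the advice built in can therefore hold a configuration of the `L/poly`
machine in its state and sweep once over `x` for every simulated step (`sweep.exists_iterate_step`).
-/

instance {A : Type} [Finite A] : Finite (Marked A) := by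
  refine Finite.of_surjective
    (fun o : Option (Option A) => match o with
      | none => Marked.lend
      | some none => Marked.rend
      | some (some a) => Marked.letter a) ?_
  rintro (_ | a | _)
  exacts [⟨none, rfl⟩, ⟨some (some a), rfl⟩, ⟨some none, rfl⟩]

instance : Finite Dir := by
  refine Finite.of_surjective
    (fun o : Option Bool => match o with
      | none => Dir.stay
      | some true => Dir.left
      | some false => Dir.right) ?_
  rintro (_ | _ | _)
  exacts [⟨some true, rfl⟩, ⟨none, rfl⟩, ⟨some false, rfl⟩]

/-! ### Reading a marked tape -/

theorem val_add_one_of_ne {n : ℕ} {p : Fin (n + 2)} (hp : (p : ℕ) ≠ n + 1) :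
    ((p + 1 : Fin _) : ℕ) = p + 1 := by
  rw [Fin.val_add_one, if_neg]
  exact fun h => hp (congrArg Fin.val h)

theorem add_one_eq_zero_of_eq {n : ℕ} {p : Fin (n + 2)} (hp : (p : ℕ) = n + 1) : p + 1 = 0 := by
  ext
  rw [Fin.val_add_one, if_pos (Fin.ext hp)]
  rfl

section Tape

variable {A : Type} {x : List A} {i : Fin (x.length + 2)}

theorem getElem?_markedTape (x : List A) (i : Fin (x.length + 2)) :
    (markedTape x)[(i : ℕ)]? = some (readCell x i) := by
  have h : (i : ℕ) < (markedTape x).length := by rw [length_markedTape]; exact i.2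
  rw [List.getElem?_eq_getElem h]
  rfl

/-- Head positions on a program tape are described by the suffix that starts at the head; scanning
the program then becomes recursion on lists. -/
theorem readCell_of_drop {s : Marked A} {l : List (Marked A)}
    (h : (markedTape x).drop i = s :: l) : readCell x i = s := by
  have h1 := getElem?_markedTape x i
  have h2 : ((markedTape x).drop i)[0]? = (markedTape x)[(i : ℕ)]? := by simp
  rw [h] at h2
  simp only [List.getElem?_cons_zero] at h2
  rw [h1] at h2
  exact (Option.some.inj h2).symm

theorem length_of_drop {l : List (Marked A)} (h : (markedTape x).drop i = l) :
    l.length + i = x.length + 2 := by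
  have h1 := congrArg List.length h
  rw [List.length_drop, length_markedTape] at h1
  have := i.2
  omega

theorem val_add_one_of_drop {s : Marked A} {l : List (Marked A)}
    (h : (markedTape x).drop i = s :: l) (hl : l ≠ []) : ((i + 1 : Fin _) : ℕ) = i + 1 := by
  have h1 := length_of_drop h
  have h2 := List.length_pos_of_ne_nil hl
  simp only [List.length_cons] at h1
  exact val_add_one_of_ne (by omega)

theorem drop_add_one {s : Marked A} {l : List (Marked A)}
    (h : (markedTape x).drop i = s :: l) (hl : l ≠ []) :
    (markedTape x).drop (i + 1 : Fin _) = l := by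
  rw [val_add_one_of_drop h hl, ← List.drop_drop, h]
  rfl

theorem add_one_eq_zero_of_drop {s : Marked A} (h : (markedTape x).drop i = [s]) : i + 1 = 0 := by
  have h1 := length_of_drop h
  simp only [List.length_singleton] at h1
  exact add_one_eq_zero_of_eq (by omega)

theorem readCell_eq_rend_iff : readCell x i = Marked.rend ↔ (i : ℕ) = x.length + 1 := by
  have h1 := getElem?_markedTape x i
  have hi := i.2
  constructor
  · intro h
    rw [h] at h1
    by_contra hne
    rcases hv : (i : ℕ) with _ | k
    · rw [hv] at h1
      simp [markedTape] at h1
    · rw [hv] at h1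
      have hk : k < x.length := by omega
      simp [markedTape, List.getElem?_append, hk] at h1
  · intro h
    rw [h] at h1
    simpa [markedTape] using h1.symm

end Tape

/-! ### Polynomially bounded functions -/

def PolyBounded (f : ℕ → ℕ) : Prop := ∃ p : Polynomial ℕ, ∀ n, f n ≤ p.eval n

theorem eval_mono (p : Polynomial ℕ) {m n : ℕ} (h : m ≤ n) : p.eval m ≤ p.eval n := by
  rw [Polynomial.eval_eq_sum, Polynomial.eval_eq_sum]
  exact Finset.sum_le_sum fun i _ => Nat.mul_le_mul_left _ (Nat.pow_le_pow_left h i)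

namespace PolyBounded

variable {f g : ℕ → ℕ}

theorem eval (p : Polynomial ℕ) : PolyBounded fun n => p.eval n := ⟨p, fun _ => le_rfl⟩

theorem const (c : ℕ) : PolyBounded fun _ => c := ⟨Polynomial.C c, fun n => by simp⟩

theorem id : PolyBounded fun n => n := ⟨Polynomial.X, fun n => by simp⟩

theorem mono (hg : PolyBounded g) (h : ∀ n, f n ≤ g n) : PolyBounded f :=
  hg.imp fun _ hp n => (h n).trans (hp n)

theorem add (hf : PolyBounded f) (hg : PolyBounded g) : PolyBounded fun n => f n + g n := by
  obtain ⟨p, hp⟩ := hf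
  obtain ⟨q, hq⟩ := hg
  exact ⟨p + q, fun n => by rw [Polynomial.eval_add]; exact Nat.add_le_add (hp n) (hq n)⟩

theorem mul (hf : PolyBounded f) (hg : PolyBounded g) : PolyBounded fun n => f n * g n := by
  obtain ⟨p, hp⟩ := hf
  obtain ⟨q, hq⟩ := hg
  exact ⟨p * q, fun n => by rw [Polynomial.eval_mul]; exact Nat.mul_le_mul (hp n) (hq n)⟩

theorem pow (hf : PolyBounded f) (k : ℕ) : PolyBounded fun n => f n ^ k := by
  obtain ⟨p, hp⟩ := hf
  exact ⟨p ^ k, fun n => by rw [Polynomial.eval_pow]; exact Nat.pow_le_pow_left (hp n) k⟩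

theorem comp (hf : PolyBounded f) (hg : PolyBounded g) : PolyBounded fun n => f (g n) := by
  obtain ⟨p, hp⟩ := hf
  obtain ⟨q, hq⟩ := hg
  exact ⟨p.comp q, fun n => by
    rw [Polynomial.eval_comp]; exact (hp _).trans (eval_mono p (hq n))⟩

theorem log_two : PolyBounded fun n => Nat.log 2 n := id.mono fun n => Nat.log_le_self 2 n

/-- Since `c ≤ 2 ^ c`, the expression is bounded by a constant times a fixed power of `2 ^ Nat.log 2
n`, which is at most `n + 1`; the summand 1 covers `n = 0`. -/
theorem pow_log (c a b : ℕ) : PolyBounded fun n => c ^ (a * Nat.log 2 n + b) := by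
  refine ((((id.add (const 1)).pow (c * a)).mul (const ((2 ^ c) ^ b)))).mono fun n => ?_
  have h1 : 2 ^ Nat.log 2 n ≤ n + 1 := by
    rcases Nat.eq_zero_or_pos n with rfl | hn
    · simp
    · exact (Nat.pow_log_le_self 2 hn.ne').trans (Nat.le_succ n)
  calc c ^ (a * Nat.log 2 n + b) ≤ (2 ^ c) ^ (a * Nat.log 2 n + b) :=
        Nat.pow_le_pow_left Nat.lt_two_pow_self.le _
    _ = (2 ^ Nat.log 2 n) ^ (c * a) * (2 ^ c) ^ b := by
        rw [pow_add, ← pow_mul 2 c (a * _), ← pow_mul 2 (Nat.log 2 n)]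
        congr 2
        ring
    _ ≤ (n + 1) ^ (c * a) * (2 ^ c) ^ b := Nat.mul_le_mul_right _ (Nat.pow_le_pow_left h1 _)

end PolyBounded

/-- This makes labels of polynomially many objects logarithmically short. A sum of two bounds costs
one extra bit. -/
theorem exists_eval_le_two_pow_log (p : Polynomial ℕ) :
    ∃ a b : ℕ, ∀ n, p.eval n ≤ 2 ^ (a * Nat.log 2 n + b) := by
  induction p using Polynomial.induction_on' with
  | add p q hp hq =>
    obtain ⟨a, b, h⟩ := hp
    obtain ⟨a', b', h'⟩ := hq
    refine ⟨a + a', b + b' + 1, fun n => ?_⟩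
    rw [Polynomial.eval_add]
    have h1 : 2 ^ (a * Nat.log 2 n + b) ≤ 2 ^ ((a + a') * Nat.log 2 n + (b + b')) :=
      Nat.pow_le_pow_right two_pos (by nlinarith [Nat.zero_le (a' * Nat.log 2 n)])
    have h2 : 2 ^ (a' * Nat.log 2 n + b') ≤ 2 ^ ((a + a') * Nat.log 2 n + (b + b')) :=
      Nat.pow_le_pow_right two_pos (by nlinarith [Nat.zero_le (a * Nat.log 2 n)])
    rw [← add_assoc, pow_succ]
    have := h n
    have := h' n
    omega
  | monomial k c =>
    refine ⟨k, c + k, fun n => ?_⟩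
    rw [Polynomial.eval_monomial]
    have h1 : n ≤ 2 ^ (Nat.log 2 n + 1) := (Nat.lt_pow_succ_log_self one_lt_two n).le
    calc c * n ^ k ≤ 2 ^ c * (2 ^ (Nat.log 2 n + 1)) ^ k :=
          Nat.mul_le_mul Nat.lt_two_pow_self.le (Nat.pow_le_pow_left h1 k)
      _ = 2 ^ (k * Nat.log 2 n + (c + k)) := by
          rw [← pow_mul, ← pow_add]; congr 1; ring

/-! ### Binary labels of the elements of a finite type -/

theorem exists_index {V : Type} [Finite V] (v₀ : V) :
    ∃ f : V → ℕ, Function.Injective f ∧ f v₀ = 0 ∧ ∀ v, f v < Nat.card V := by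
  have : NeZero (Nat.card V) := ⟨(Nat.card_pos_iff.2 ⟨⟨v₀⟩, inferInstance⟩).ne'⟩
  let e := Finite.equivFin V
  refine ⟨fun v => (Equiv.swap (e v₀) 0 (e v) : Fin (Nat.card V)), ?_, ?_, fun v => Fin.is_lt _⟩
  · intro u v h
    exact e.injective ((Equiv.swap (e v₀) 0).injective (Fin.ext h))
  · simp

/-- Labels are binary digits of an enumeration that starts with `v₀`. The all-false label of `v₀`
agrees with a blank work tape, so no initialisation is needed. -/
theorem exists_label {V : Type} [Finite V] (v₀ : V) {w : ℕ} (hw : Nat.card V ≤ 2 ^ w) :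
    ∃ f : V → ℕ → Bool, (f v₀ = fun _ => false) ∧ (∀ v j, w ≤ j → f v j = false) ∧
      ∀ u v, (∀ j < w, f u j = f v j) → u = v := by
  obtain ⟨g, hg, h0, hlt⟩ := exists_index v₀
  have hz : ∀ v j, w ≤ j → (g v).testBit j = false := fun v j hj =>
    Nat.testBit_eq_false_of_lt
      (((hlt v).trans_le hw).trans_le (Nat.pow_le_pow_right two_pos hj))
  refine ⟨fun v j => (g v).testBit j, ?_, hz, fun u v h => hg (Nat.eq_of_testBit_eq fun j => ?_)⟩
  · funext j
    simp [h0]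
  · rcases lt_or_ge j w with hj | hj
    · exact h j hj
    · rw [hz u j hj, hz v j hj]

/-! ### Work tapes of bounded length -/

/-- A work tape with the cells `0, …, S`, together with a head position. -/
abbrev Store (W : Type) (S : ℕ) : Type := Fin (S + 1) × (Fin (S + 1) → W)

namespace Store

variable {W : Type} {S : ℕ}

def ofTape (S p : ℕ) (f : ℕ → W) : Store W S :=
  (⟨min p S, Nat.lt_succ_of_le (min_le_right p S)⟩, fun i => f i)

def read (s : Store W S) : W := s.2 s.1

def write (s : Store W S) (a : W) (d : Dir) : Store W S :=
  (⟨min (d.moveWork s.1) S, Nat.lt_succ_of_le (min_le_right _ S)⟩, Function.update s.2 s.1 a)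

theorem read_ofTape {p : ℕ} (h : p ≤ S) (f : ℕ → W) : (ofTape S p f).read = f p := by
  simp [ofTape, read, h]

/-- Only the old head position has to be in range: if the move leaves the cells `0, …, S`, both
sides clamp the new position in the same way. -/
theorem write_ofTape {p : ℕ} (h : p ≤ S) (f : ℕ → W) (a : W) (d : Dir) :
    (ofTape S p f).write a d = ofTape S (d.moveWork p) (Function.update f p a) := by
  ext i
  · simp [ofTape, write, h]
  · simp only [ofTape, write, Function.update_apply, Fin.ext_iff, min_eq_left h]

theorem card [Finite W] : Nat.card (Store W S) = (S + 1) * Nat.card W ^ (S + 1) := by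
  rw [Nat.card_prod, Nat.card_fun, Nat.card_fin]

theorem polyBounded_card (W : Type) [Finite W] (a b : ℕ) :
    PolyBounded fun n => Nat.card (Store W (a * Nat.log 2 n + b)) := by
  refine ((((PolyBounded.const a).mul PolyBounded.log_two).add (PolyBounded.const (b + 1))).mul
    (PolyBounded.pow_log (Nat.card W) a (b + 1))).mono fun n => ?_
  rw [card]
  exact le_of_eq (by simp only [add_assoc])

end Store

/-! ### Space-bounded nondeterministic Turing machines on inputs of a fixed length -/

namespace NTM

variable {A : Type} (M : NTM A)

/-- The two-way automaton whose states hold a state of `M` and a work tape with cells `0, …, S`. -/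
def toTwoNFA (S : ℕ) : TwoNFA A where
  State := M.State × Store M.Work S
  finite_state := by
    have := M.finite_state
    have := M.finite_work
    infer_instance
  start := (M.start, Store.ofTape S 0 fun _ => M.blank)
  acc := {q | q.1 ∈ M.acc}
  rej := {q | q.1 ∈ M.rej}
  disjoint_halt := Set.disjoint_left.2 fun _ h h' => Set.disjoint_left.1 M.disjoint_halt h h'
  trans q a := {m | ∃ t ∈ M.trans q.1 a q.2.read, m = ((t.1, q.2.write t.2.2.1 t.2.2.2), t.2.1)}

variable {M} {S : ℕ} {x : List A}

def Conf.toTwoConf (S : ℕ) (c : M.Conf x) : TwoConf (M.toTwoNFA S).State x :=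
  ⟨(c.state, Store.ofTape S c.workPos c.work), c.inPos⟩

theorem Step.toTwoNFA {c c' : M.Conf x} (h : M.Step x c c') (hc : c.workPos ≤ S) :
    (M.toTwoNFA S).Step x (c.toTwoConf S) (c'.toTwoConf S) := by
  obtain ⟨hh, m, hm, rfl⟩ := h
  refine ⟨hh, ((m.1, (Store.ofTape S c.workPos c.work).write m.2.2.1 m.2.2.2), m.2.1),
    ⟨m, ?_, rfl⟩, ?_⟩
  · rw [← Store.read_ofTape hc c.work] at hm
    exact hm
  · simp only [Conf.toTwoConf, Store.write_ofTape hc]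

theorem exists_step_of_toTwoNFA {c : M.Conf x} {b : TwoConf (M.toTwoNFA S).State x}
    (h : (M.toTwoNFA S).Step x (c.toTwoConf S) b) (hc : c.workPos ≤ S) :
    ∃ c', M.Step x c c' ∧ c'.toTwoConf S = b := by
  obtain ⟨hh, m, ⟨t, ht, rfl⟩, rfl⟩ := h
  have ht' : t ∈ M.trans c.state (readCell x c.inPos) (c.work c.workPos) := by
    rw [← Store.read_ofTape hc c.work]
    exact ht
  refine ⟨_, ⟨hh, t, ht', rfl⟩, ?_⟩
  simp only [Conf.toTwoConf, Store.write_ofTape hc]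

/-- Under `hS` the clamping never takes effect on reachable configurations, so truncating the work
tape matches steps in both directions. -/
theorem toTwoNFA_accepts_iff (hS : ∀ c, M.Reachable x c → c.workPos ≤ S) :
    (M.toTwoNFA S).Accepts x ↔ M.Accepts x := by
  constructor
  · rintro ⟨b, hb, hacc⟩
    have : ∃ c, M.Reachable x c ∧ c.toTwoConf S = b := by
      clear hacc
      induction hb with
      | refl => exact ⟨M.init x, .refl, rfl⟩
      | tail _ hs ih =>
        obtain ⟨c, hc, rfl⟩ := ih
        obtain ⟨c', hs', rfl⟩ := exists_step_of_toTwoNFA hs (hS c hc)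
        exact ⟨c', hc.tail hs', rfl⟩
    obtain ⟨c, hc, rfl⟩ := this
    exact ⟨c, hc, hacc⟩
  · rintro ⟨c, hc, hacc⟩
    refine ⟨c.toTwoConf S, ?_, hacc⟩
    clear hacc
    induction hc with
    | refl => exact .refl
    | tail hc hs ih => exact ih.tail (hs.toTwoNFA (hS _ hc))

theorem card_toTwoNFA (M : NTM A) (S : ℕ) :
    Nat.card (M.toTwoNFA S).State = Nat.card M.State * Nat.card (Store M.Work S) :=
  Nat.card_prod _ _

end NTM

/-! ### Bounded-space runs of deterministic machines with advice -/

namespace AdvisedDTM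

variable {A B : Type} (M : AdvisedDTM A B) (x : List A) (w : List B) (S : ℕ)

/-- `c'` is reached from `c`, and up to then the work head stays in the cells `0, …, S`. -/
def ReachIn (c c' : M.Conf x w) : Prop :=
  Relation.ReflTransGen (fun a b => M.step x w a = b ∧ a.workPos ≤ S) c c'

variable {M x w S}

theorem ReachIn.trans {a b c : M.Conf x w} (h : M.ReachIn x w S a b) (h' : M.ReachIn x w S b c) :
    M.ReachIn x w S a c := Relation.ReflTransGen.trans h h'

theorem ReachIn.head {a b c : M.Conf x w} (hs : M.step x w a = b) (ha : a.workPos ≤ S)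
    (h : M.ReachIn x w S b c) : M.ReachIn x w S a c := Relation.ReflTransGen.head ⟨hs, ha⟩ h

theorem step_of_mem {c : M.Conf x w} (h : c.state ∈ M.acc ∪ M.rej) : M.step x w c = c := if_pos h

theorem iterate_step_of_mem {c : M.Conf x w} (h : c.state ∈ M.acc ∪ M.rej) (t : ℕ) :
    (M.step x w)^[t] c = c := Function.iterate_fixed (step_of_mem h) t

/-- A halting configuration is a fixed point, so every iterate lies on the path or equals `d`; the
space bound then holds at all times. `ReachIn` bounds only the sources of steps, hence the separate
assumption on `d`. -/
theorem ReachIn.exists_iterate {c d : M.Conf x w} (h : M.ReachIn x w S c d)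
    (hd : d.state ∈ M.acc ∪ M.rej) (hS : d.workPos ≤ S) :
    (∃ t, (M.step x w)^[t] c = d) ∧ ∀ t, ((M.step x w)^[t] c).workPos ≤ S := by
  induction h using Relation.ReflTransGen.head_induction_on with
  | refl => exact ⟨⟨0, rfl⟩, fun t => by rwa [iterate_step_of_mem hd]⟩
  | head hs _ ih =>
    obtain ⟨rfl, ha⟩ := hs
    obtain ⟨⟨t, ht⟩, hall⟩ := ih
    refine ⟨⟨t + 1, ht⟩, fun t => ?_⟩
    rcases t with _ | t
    · exact ha
    · exact hall t

end AdvisedDTM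

/-! ### Interpreting a two-way deterministic automaton given as advice -/

/-- The letters of the advice. The automaton is written as a list of blocks, one for each state;
a block compares its label with the contents of the work tape and, if they agree, replaces them
by the label of the next state and moves the input head. -/
inductive Code (A : Type) : Type where
  | cmp (b : Bool)
  | put (f : Marked A → Bool)
  | next (f : Marked A → Dir)
  | halt (b : Bool)

instance {A : Type} [Finite A] : Finite (Code A) := by
  refine Finite.of_surjective
    (fun o : (Bool ⊕ Bool) ⊕ ((Marked A → Bool) ⊕ (Marked A → Dir)) => match o with
      | .inl (.inl b) => Code.cmp b
      | .inl (.inr b) => Code.halt b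
      | .inr (.inl f) => Code.put f
      | .inr (.inr f) => Code.next f) ?_
  rintro (b | f | f | b)
  exacts [⟨.inl (.inl b), rfl⟩, ⟨.inr (.inl f), rfl⟩, ⟨.inr (.inr f), rfl⟩, ⟨.inl (.inr b), rfl⟩]

/-- States of the interpreter: `running ok` where `ok` tells that no comparison has failed in the
current block, and `halted b` with the verdict `b`. -/
inductive Interp : Type where
  | running (ok : Bool)
  | halted (b : Bool)

instance : Finite Interp := by
  refine Finite.of_surjective
    (fun o : Bool ⊕ Bool => match o with
      | .inl b => Interp.running b
      | .inr b => Interp.halted b) ?_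
  rintro (b | b)
  exacts [⟨.inl b, rfl⟩, ⟨.inr b, rfl⟩]

/-- A block whose comparison failed is still traversed with the same work head moves, so the head is
back in cell 0 at its end. The flag only suppresses writing, moving the input head and halting, and
it is reset after each block and at the endmarkers. -/
def interpTrans {A : Type} :
    Interp → Marked A → Marked (Code A) → Bool → Interp × Dir × Dir × Bool × Dir
  | .halted b, _, _, s => (.halted b, .stay, .stay, s, .stay)
  | .running ok, _, .letter (.cmp b), s => (.running (ok && s == b), .stay, .right, s, .right)
  | .running ok, a, .letter (.put f), s =>
      (.running ok, .stay, .right, if ok then f a else s, .left)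
  | .running ok, a, .letter (.next f), s =>
      (.running true, if ok then f a else .stay, .right, s, .stay)
  | .running ok, _, .letter (.halt b), s =>
      (if ok then .halted b else .running true, .stay, .right, s, .stay)
  | .running _, _, .lend, s => (.running true, .stay, .right, s, .stay)
  | .running _, _, .rend, s => (.running true, .stay, .right, s, .stay)

abbrev interp (A : Type) : AdvisedDTM A (Code A) where
  State := Interp
  finite_state := inferInstance
  Work := Bool
  finite_work := inferInstance
  blank := false
  start := .running true
  acc := {.halted true}
  rej := {.halted false}
  disjoint_halt := by simp
  trans := interpTrans

namespace interp

variable {A : Type} {x : List A} {w : List (Code A)} {S : ℕ}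

/-- A running configuration of the interpreter. -/
abbrev conf (ok : Bool) (p : Fin (x.length + 2)) (i : Fin (w.length + 2)) (k : ℕ) (f : ℕ → Bool) :
    (interp A).Conf x w := ⟨.running ok, p, i, k, f⟩

theorem running_not_mem (ok : Bool) : Interp.running ok ∉ (interp A).acc ∪ (interp A).rej := by
  rintro (h | h) <;> cases h

theorem step_conf {ok : Bool} {p : Fin (x.length + 2)} {i : Fin (w.length + 2)} {k : ℕ}
    {f : ℕ → Bool} {s : Marked (Code A)} {l : List (Marked (Code A))}
    (h : (markedTape w).drop i = s :: l) :
    (interp A).step x w (conf ok p i k f) =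
      let m := interpTrans (.running ok) (readCell x p) s (f k)
      ⟨m.1, m.2.1.moveCirc p, m.2.2.1.moveCirc i, m.2.2.2.2.moveWork k,
        Function.update f k m.2.2.2.1⟩ := by
  refine (if_neg (running_not_mem ok)).trans ?_
  simp only [readCell_of_drop h]

/-- Comparisons with the bits `g k, …, g (k + m - 1)`. -/
def cmps (g : ℕ → Bool) : ℕ → ℕ → List (Code A)
  | _, 0 => []
  | k, m + 1 => .cmp (g k) :: cmps g (k + 1) m

/-- Instructions that write the bits `g k, …, g 0`. -/
def puts (g : Marked A → ℕ → Bool) : ℕ → List (Code A)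
  | 0 => [.put fun a => g a 0]
  | k + 1 => .put (fun a => g a (k + 1)) :: puts g k

theorem length_cmps (g : ℕ → Bool) (k m : ℕ) : (cmps g k m : List (Code A)).length = m := by
  induction m generalizing k with
  | zero => rfl
  | succ m ih => simp [cmps, ih]

theorem length_puts (g : Marked A → ℕ → Bool) (k : ℕ) : (puts g k).length = k + 1 := by
  induction k with
  | zero => rfl
  | succ k ih => simp [puts, ih]

theorem reachIn_cmps (g : ℕ → Bool) (m : ℕ) {k : ℕ} {ok : Bool} {p : Fin (x.length + 2)} {f : ℕ → Bool}
    {i : Fin (w.length + 2)} {l : List (Marked (Code A))} (hl : l ≠ [])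
    (hi : (markedTape w).drop i = (cmps g k m).map Marked.letter ++ l) (hk : k + m ≤ S) :
    ∃ (ok' : Bool) (i' : Fin (w.length + 2)), (markedTape w).drop i' = l ∧
      (ok' = true ↔ ok = true ∧ ∀ j, k ≤ j → j < k + m → f j = g j) ∧
      (interp A).ReachIn x w S (conf ok p i k f) (conf ok' p i' (k + m) f) := by
  induction m generalizing k ok i with
  | zero =>
    refine ⟨ok, i, hi, ?_, .refl⟩
    constructor
    · exact fun h => ⟨h, fun j h1 h2 => by omega⟩
    · exact fun h => h.1
  | succ m ih =>
    simp only [cmps, List.map_cons, List.cons_append] at hi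
    have hne : (cmps g (k + 1) m).map Marked.letter ++ l ≠ [] := by simp [hl]
    obtain ⟨ok', i', hi', hok, hr⟩ := ih (ok := ok && f k == g k) (drop_add_one hi hne) (by omega)
    refine ⟨ok', i', hi', ?_, ?_⟩
    · rw [hok, Bool.and_eq_true, beq_iff_eq, and_assoc]
      refine and_congr_right fun _ => ⟨fun h j h1 h2 => ?_, fun h => ?_⟩
      · rcases h1.eq_or_lt with rfl | h1
        · exact h.1
        · exact h.2 j h1 (by omega)
      · exact ⟨h k le_rfl (by omega), fun j h1 h2 => h j (by omega) (by omega)⟩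
    · refine .head ?_ ?_ (by rw [show k + (m + 1) = k + 1 + m by omega]; exact hr)
      · rw [step_conf hi]
        simp only [interpTrans, Function.update_eq_self]
        rfl
      · change k ≤ S
        omega

theorem reachIn_puts (g : Marked A → ℕ → Bool) {k : ℕ} {ok : Bool} {p : Fin (x.length + 2)} {f : ℕ → Bool}
    {i : Fin (w.length + 2)} {l : List (Marked (Code A))} (hl : l ≠ [])
    (hi : (markedTape w).drop i = (puts g k).map Marked.letter ++ l) (hk : k ≤ S) :
    ∃ i' : Fin (w.length + 2), (markedTape w).drop i' = l ∧
      (interp A).ReachIn x w S (conf ok p i k f) (conf ok p i' 0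
        (if ok then fun j => if j ≤ k then g (readCell x p) j else f j else f)) := by
  induction k generalizing f i with
  | zero =>
    simp only [puts, List.map_cons, List.cons_append, List.map_nil, List.nil_append] at hi
    refine ⟨_, drop_add_one hi hl, .head ?_ hk .refl⟩
    rw [step_conf hi]
    simp only [interpTrans]
    rcases ok with _ | _
    · simp [conf, Dir.moveWork, Dir.moveCirc]
    · simp only [conf, Dir.moveWork, Dir.moveCirc, if_true, Nat.le_zero, AdvisedDTM.Conf.mk.injEq,
        true_and]
      funext j
      by_cases hj : j = 0
      · subst hj; simp
      · simp [hj]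
  | succ k ih =>
    simp only [puts, List.map_cons, List.cons_append] at hi
    have hne : (puts g k).map Marked.letter ++ l ≠ [] := by simp [hl]
    obtain ⟨i', hi', hr⟩ := ih (f := Function.update f (k + 1)
      (if ok then g (readCell x p) (k + 1) else f (k + 1))) (drop_add_one hi hne) (by omega)
    refine ⟨i', hi', .head ?_ hk (b := conf ok p (i + 1) k (Function.update f (k + 1)
      (if ok then g (readCell x p) (k + 1) else f (k + 1)))) ?_⟩
    · rw [step_conf hi]
      rfl
    · convert hr using 2
      rcases ok with _ | _
      · simp
      · simp only [if_true]
        funext j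
        by_cases hj : j ≤ k
        · simp [hj, Nat.le_succ_of_le hj]
        · by_cases hj' : j = k + 1
          · subst hj'; simp
          · simp [hj, hj', show ¬ j ≤ k + 1 by omega]

end interp

/-! ### Halting computations of two-way deterministic automata -/

namespace TwoDFA

variable {A : Type} {N : TwoDFA A} {x : List A}

theorem step_of_mem {c : TwoConf N.State x} (h : c.state ∈ N.acc ∪ N.rej) : N.step x c = c :=
  if_pos h

theorem iterate_step_of_mem {c : TwoConf N.State x} (h : c.state ∈ N.acc ∪ N.rej) (t : ℕ) :
    (N.step x)^[t] c = c := Function.iterate_fixed (step_of_mem h) t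

theorem iterate_eq_of_mem {c : TwoConf N.State x} {m t : ℕ}
    (hm : ((N.step x)^[m] c).state ∈ N.acc ∪ N.rej)
    (ht : ((N.step x)^[t] c).state ∈ N.acc ∪ N.rej) : (N.step x)^[m] c = (N.step x)^[t] c := by
  rcases le_total m t with h | h
  · obtain ⟨k, rfl⟩ := Nat.exists_eq_add_of_le' h
    rw [Function.iterate_add_apply, iterate_step_of_mem hm]
  · obtain ⟨k, rfl⟩ := Nat.exists_eq_add_of_le' h
    rw [Function.iterate_add_apply, iterate_step_of_mem ht]

/-- The halting states with the verdict `b`. -/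
def verdict (N : TwoDFA A) (b : Bool) : Set N.State := if b then N.acc else N.rej

theorem verdict_subset (b : Bool) : N.verdict b ⊆ N.acc ∪ N.rej := by
  rcases b with _ | _
  · exact Set.subset_union_right
  · exact Set.subset_union_left

theorem verdict_unique {b b' : Bool} {q : N.State} (h : q ∈ N.verdict b) (h' : q ∈ N.verdict b') :
    b = b' := by
  have hd := Set.disjoint_left.1 N.disjoint_halt
  rcases b with _ | _ <;> rcases b' with _ | _
  · rfl
  · exact (hd h' h).elim
  · exact (hd h h').elim
  · rfl

end TwoDFA

/-! ### The advice string and the correctness of the interpreter -/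

namespace interp

variable {A : Type} (N : TwoDFA A) (lab : N.State → ℕ → Bool) (d : ℕ)

open Classical in
noncomputable def lastCode (q : N.State) : Code A :=
  if q ∈ N.acc then .halt true else if q ∈ N.rej then .halt false
  else .next fun a => (N.trans q a).2

/-- The `d` comparisons leave the work head in cell `d`, where the `d + 1` write instructions start
on their way back to cell 0. -/
noncomputable def block (q : N.State) : List (Code A) :=
  cmps (lab q) 0 d ++ (puts (fun a => lab (N.trans q a).1) d ++ [lastCode N q])

theorem length_block (q : N.State) : (block N lab d q).length = 2 * d + 2 := by
  simp only [block, List.length_append, length_cmps, length_puts, List.length_singleton]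
  omega

noncomputable def advice (qs : List N.State) : List (Code A) := qs.flatMap (block N lab d)

theorem length_advice (qs : List N.State) :
    (advice N lab d qs).length = qs.length * (2 * d + 2) := by
  simp [advice, List.length_flatMap, length_block]

variable {N lab d} {x : List A} {w : List (Code A)}

/-- The configuration of the interpreter at the beginning of a block. -/
abbrev confOf (lab : N.State → ℕ → Bool) (c : TwoConf N.State x) (i : Fin (w.length + 2)) :
    (interp A).Conf x w := conf true c.pos i 0 (lab c.state)

/-- From `a`, the interpreter halts with the verdict of `c`. -/
def Halts (S : ℕ) (a : (interp A).Conf x w) (c : TwoConf N.State x) : Prop :=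
  ∃ (b : Bool) (e : (interp A).Conf x w), (interp A).ReachIn x w S a e ∧
    e.state = .halted b ∧ e.workPos ≤ S ∧ c.state ∈ N.verdict b

theorem Halts.of_reachIn {S : ℕ} {a a' : (interp A).Conf x w} {c : TwoConf N.State x}
    (h : Halts S a' c) (hr : (interp A).ReachIn x w S a a') : Halts S a c := by
  obtain ⟨b, e, he, h⟩ := h
  exact ⟨b, e, hr.trans he, h⟩

open Classical in
-- By injectivity of the labels the comparisons succeed exactly when `q` is the current state. The
-- last conjunct records that a matching block is left only if the state is not halting; this forces
-- the interpreter to stop when `N` does.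
theorem pass_block (hz : ∀ q j, d ≤ j → lab q j = false)
    (hinj : ∀ q q', (∀ j < d, lab q j = lab q' j) → q = q') {q : N.State} (c : TwoConf N.State x)
    {i : Fin (w.length + 2)} {l : List (Marked (Code A))} (hl : l ≠ [])
    (hi : (markedTape w).drop i = (block N lab d q).map Marked.letter ++ l) :
    Halts d (confOf lab c i) c ∨
      ∃ i' : Fin (w.length + 2), (markedTape w).drop i' = l ∧ (interp A).ReachIn x w d
        (confOf lab c i) (confOf lab (if c.state = q then N.step x c else c) i') ∧
        (c.state = q → c.state ∉ N.acc ∪ N.rej) := by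
  simp only [block, List.map_append, List.append_assoc, List.map_cons, List.map_nil,
    List.cons_append, List.nil_append] at hi
  obtain ⟨ok, i₁, hi₁, hok, hr₁⟩ := reachIn_cmps (x := x) (S := d) (ok := true) (p := c.pos)
    (f := lab c.state) (lab q) d (by simp) hi (by omega)
  rw [Nat.zero_add] at hr₁
  have hok' : ok = true ↔ c.state = q := by
    rw [hok]
    exact ⟨fun h => hinj _ _ fun j hj => h.2 j (Nat.zero_le _) (by omega),
      fun h => ⟨rfl, fun j _ _ => by rw [h]⟩⟩
  obtain ⟨i₂, hi₂, hr₂⟩ := reachIn_puts (x := x) (S := d) (ok := ok) (p := c.pos)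
    (f := lab c.state) (fun a => lab (N.trans q a).1) (by simp) hi₁ le_rfl
  have hr := hr₁.trans hr₂
  by_cases hq : c.state = q
  · have hok1 := hok'.2 hq
    subst hok1
    -- Beyond cell `d` the old label remains, but there all labels are false.
    have hf : (if true = true then fun j => if j ≤ d then lab (N.trans q (readCell x c.pos)).1 j
        else lab c.state j else lab c.state) = lab (N.trans q (readCell x c.pos)).1 := by
      rw [if_pos rfl]
      funext j
      split_ifs with hj
      · rfl
      · rw [hz _ j (by omega), hz _ j (by omega)]
    rw [hf] at hr
    have hs := step_conf (x := x) (ok := true) (p := c.pos) (k := 0)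
      (f := lab (N.trans q (readCell x c.pos)).1) hi₂
    by_cases h : ∃ b, c.state ∈ N.verdict b
    · left
      obtain ⟨b, hb⟩ := h
      have hlast : lastCode N q = .halt b := by
        subst hq
        rcases b with _ | _
        · have : c.state ∉ N.acc := fun h' => absurd (TwoDFA.verdict_unique (b' := true) hb h')
            (by simp)
          exact (if_neg this).trans (if_pos hb)
        · exact if_pos hb
      rw [hlast] at hs
      exact ⟨b, _, hr.trans (.head hs (Nat.zero_le _) .refl), rfl, Nat.zero_le _, hb⟩
    · right
      have ha : c.state ∉ N.acc := fun h' => h ⟨true, h'⟩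
      have hrej : c.state ∉ N.rej := fun h' => h ⟨false, h'⟩
      have hh : c.state ∉ N.acc ∪ N.rej := fun h' => h'.elim ha hrej
      have hlast : lastCode N q = .next fun a => (N.trans q a).2 := by
        subst hq
        exact (if_neg ha).trans (if_neg hrej)
      rw [hlast] at hs
      refine ⟨_, drop_add_one hi₂ hl, hr.trans (.head hs (Nat.zero_le _) ?_), fun _ => hh⟩
      rw [if_pos hq, TwoDFA.step, if_neg hh, hq]
      simp only [interpTrans, Function.update_eq_self, if_true]
      exact .refl
  · right
    have hok1 : ok = false := by
      rcases ok with _ | _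
      · rfl
      · exact (hq (hok'.1 rfl)).elim
    subst hok1
    refine ⟨_, drop_add_one hi₂ hl, hr.trans ?_, fun h => (hq h).elim⟩
    rw [if_neg hq]
    refine .head (step_conf hi₂) (Nat.zero_le _) ?_
    -- With the flag down, all three possible last instructions act alike.
    have : interpTrans (.running false) (readCell x c.pos) (.letter (lastCode N q))
        (lab c.state 0) = (.running true, .stay, .right, lab c.state 0, .stay) := by
      unfold lastCode
      split_ifs <;> rfl
    simp only [Bool.false_eq_true, if_false, this, Function.update_eq_self]
    exact .refl

/-- The number `m` of simulated steps is not fixed, since a later block may match the state produced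
by an earlier one. It is positive once the current state has a block. -/
theorem pass_blocks (hz : ∀ q j, d ≤ j → lab q j = false)
    (hinj : ∀ q q', (∀ j < d, lab q j = lab q' j) → q = q') (qs : List N.State)
    (c : TwoConf N.State x) {i : Fin (w.length + 2)} {l : List (Marked (Code A))} (hl : l ≠ [])
    (hi : (markedTape w).drop i = (advice N lab d qs).map Marked.letter ++ l) :
    ∃ m, Halts d (confOf lab c i) ((N.step x)^[m] c) ∨
      ∃ i' : Fin (w.length + 2), (markedTape w).drop i' = l ∧ (interp A).ReachIn x w d
        (confOf lab c i) (confOf lab ((N.step x)^[m] c) i') ∧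
        (c.state ∈ qs → c.state ∉ N.acc ∪ N.rej ∧ 0 < m) := by
  induction qs generalizing c i with
  | nil => exact ⟨0, .inr ⟨i, hi, .refl, by simp⟩⟩
  | cons q qs ih =>
    have hi' : (markedTape w).drop i = (block N lab d q).map Marked.letter ++
        ((advice N lab d qs).map Marked.letter ++ l) := by
      rw [hi, advice, List.flatMap_cons, List.map_append, List.append_assoc]
      rfl
    rcases pass_block hz hinj c (by simp [hl]) hi' with h | ⟨i₁, hi₁, hr, hq⟩
    · exact ⟨0, .inl h⟩
    · by_cases hc : c.state = q
      · rw [if_pos hc] at hr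
        obtain ⟨m, h | ⟨i₂, hi₂, hr', -⟩⟩ := ih (N.step x c) hi₁
        · exact ⟨m + 1, .inl (h.of_reachIn hr)⟩
        · exact ⟨m + 1, .inr ⟨i₂, hi₂, hr.trans hr', fun _ => ⟨hq hc, Nat.succ_pos m⟩⟩⟩
      · rw [if_neg hc] at hr
        obtain ⟨m, h | ⟨i₂, hi₂, hr', hm⟩⟩ := ih c hi₁
        · exact ⟨m, .inl (h.of_reachIn hr)⟩
        · refine ⟨m, .inr ⟨i₂, hi₂, hr.trans hr', fun hmem => hm ?_⟩⟩
          exact (List.mem_cons.1 hmem).resolve_left hc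

theorem drop_one (w : List (Code A)) :
    (markedTape w).drop (1 : Fin (w.length + 2)) = w.map Marked.letter ++ [Marked.rend] := rfl

theorem drop_zero (w : List (Code A)) : (markedTape w).drop (0 : Fin (w.length + 2)) =
    Marked.lend :: (w.map Marked.letter ++ [Marked.rend]) := rfl

theorem reachIn_lend (c : TwoConf N.State x) :
    (interp A).ReachIn x w d (confOf lab c 0) (confOf lab c 1) := by
  refine .head (step_conf (drop_zero w)) (Nat.zero_le _) ?_
  simp only [interpTrans, Function.update_eq_self, Dir.moveCirc, zero_add]
  exact .refl

/-- One pass of the advice head over all blocks. -/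
theorem round (hz : ∀ q j, d ≤ j → lab q j = false)
    (hinj : ∀ q q', (∀ j < d, lab q j = lab q' j) → q = q') {qs : List N.State}
    (hqs : ∀ q, q ∈ qs) (c : TwoConf N.State x) :
    ∃ m, Halts d (confOf (w := advice N lab d qs) lab c 1) ((N.step x)^[m] c) ∨
      ((interp A).ReachIn x (advice N lab d qs) d (confOf lab c 1)
        (confOf lab ((N.step x)^[m] c) 1) ∧ c.state ∉ N.acc ∪ N.rej ∧ 0 < m) := by
  obtain ⟨m, h | ⟨i, hi, hr, hm⟩⟩ := pass_blocks hz hinj qs c (by simp) (drop_one _)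
  · exact ⟨m, .inl h⟩
  · refine ⟨m, .inr ⟨hr.trans (.head (step_conf hi) (Nat.zero_le _) ?_), hm (hqs _)⟩⟩
    simp only [interpTrans, Function.update_eq_self, Dir.moveCirc, add_one_eq_zero_of_drop hi]
    exact reachIn_lend _

/-- Every round that does not halt simulates at least one step, so `T` rounds suffice. -/
theorem halts_or_reachIn (hz : ∀ q j, d ≤ j → lab q j = false)
    (hinj : ∀ q q', (∀ j < d, lab q j = lab q' j) → q = q') {qs : List N.State}
    (hqs : ∀ q, q ∈ qs) (c : TwoConf N.State x) (T : ℕ) :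
    (∃ m, Halts d (confOf (w := advice N lab d qs) lab c 1) ((N.step x)^[m] c)) ∨
      ∃ m, T ≤ m ∧ (interp A).ReachIn x (advice N lab d qs) d (confOf lab c 1)
        (confOf lab ((N.step x)^[m] c) 1) := by
  induction T with
  | zero => exact .inr ⟨0, le_rfl, .refl⟩
  | succ T ih =>
    obtain h | ⟨m, hm, hr⟩ := ih
    · exact .inl h
    · obtain ⟨k, h⟩ := round hz hinj hqs ((N.step x)^[m] c)
      rw [← Function.iterate_add_apply] at h
      obtain h | ⟨hr', -, hk⟩ := h
      · exact .inl ⟨_, h.of_reachIn hr⟩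
      · exact .inr ⟨_, by omega, hr.trans hr'⟩

/-- If the interpreter is still running after `T` or more simulated steps, it holds the halting
configuration of `N`, and a round from there cannot return. Any two halting iterates coincide, so
the verdict is that of step `T`. -/
theorem halts_of_mem (hz : ∀ q j, d ≤ j → lab q j = false)
    (hinj : ∀ q q', (∀ j < d, lab q j = lab q' j) → q = q') {qs : List N.State}
    (hqs : ∀ q, q ∈ qs) (c : TwoConf N.State x) {T : ℕ} {b : Bool}
    (hT : ((N.step x)^[T] c).state ∈ N.verdict b) :
    Halts d (confOf (w := advice N lab d qs) lab c 1) ((N.step x)^[T] c) := by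
  have hT' := TwoDFA.verdict_subset b hT
  have key : ∃ m, Halts d (confOf (w := advice N lab d qs) lab c 1) ((N.step x)^[m] c) := by
    obtain h | ⟨m, hm, hr⟩ := halts_or_reachIn hz hinj hqs c T
    · exact h
    · obtain ⟨k, h⟩ := round hz hinj hqs ((N.step x)^[m] c)
      have hk : (N.step x)^[m] c = (N.step x)^[T] c := by
        obtain ⟨k, rfl⟩ := Nat.exists_eq_add_of_le' hm
        rw [Function.iterate_add_apply, TwoDFA.iterate_step_of_mem hT']
      obtain h | ⟨-, hn, -⟩ := h
      · rw [← Function.iterate_add_apply] at h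
        exact ⟨_, h.of_reachIn hr⟩
      · rw [hk] at hn
        exact (hn hT').elim
  obtain ⟨m, h⟩ := key
  obtain ⟨b', _, _, _, _, hb⟩ := id h
  rwa [TwoDFA.iterate_eq_of_mem (TwoDFA.verdict_subset b' hb) hT'] at h

theorem correct (h0 : lab N.start = fun _ => false) (hz : ∀ q j, d ≤ j → lab q j = false)
    (hinj : ∀ q q', (∀ j < d, lab q j = lab q' j) → q = q') {qs : List N.State}
    (hqs : ∀ q, q ∈ qs) {T : ℕ} {b : Bool}
    (hT : ((N.step x)^[T] (N.init x)).state ∈ N.verdict b) :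
    (∃ t, ((interp A).run x (advice N lab d qs) t).state = .halted b) ∧
      ∀ t, ((interp A).run x (advice N lab d qs) t).workPos ≤ d := by
  obtain ⟨b', e, hr, he, hp, hb⟩ := halts_of_mem hz hinj hqs (N.init x) hT
  obtain rfl := TwoDFA.verdict_unique hT hb
  have hinit : (interp A).init x (advice N lab d qs) = confOf lab (N.init x) 0 := by
    simp only [AdvisedDTM.init, confOf, conf, TwoDFA.init, h0]
  have hr' := (reachIn_lend (lab := lab) (d := d) (w := advice N lab d qs) (N.init x)).trans hr
  rw [← hinit] at hr'
  have hmem : e.state ∈ (interp A).acc ∪ (interp A).rej := by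
    rw [he]
    rcases b with _ | _
    · exact .inr rfl
    · exact .inl rfl
  obtain ⟨⟨t, ht⟩, hall⟩ := hr'.exists_iterate hmem hp
  exact ⟨⟨t, by rw [AdvisedDTM.run, ht, he]⟩, hall⟩

end interp

/-- If `2N/poly ⊆ 2D` then `NL ⊆ L/poly`. -/
theorem NL_subset_LPoly (H : TwoNPoly ⊆ TwoD) : NL ⊆ LPoly := by
  rintro P ⟨M, ⟨a, b, hS⟩, hM⟩
  have := M.finite_state
  have := M.finite_work
  have := P.finite_alph
  -- Every string of length `n` is promised, so the deterministic automata obtained for `F` halt on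
  -- all of them.
  let F : PromiseFamily :=
    { Alph := P.Alph
      finite_alph := P.finite_alph
      nonempty_alph := P.nonempty_alph
      pos := fun n => {x | x.length = n ∧ x ∈ P.yes}
      neg := fun n => {x | x.length = n ∧ x ∉ P.yes}
      disjoint_pos_neg := fun n => Set.disjoint_left.2 fun _ h h' => h'.2 h.2 }
  have hF : F ∈ TwoNPoly := by
    refine ⟨?_, Polynomial.X, fun n x hx => ?_⟩
    · obtain ⟨p, hp⟩ := (PolyBounded.const (Nat.card M.State)).mul
        (Store.polyBounded_card M.Work a b)
      have hacc : ∀ x : List P.Alph,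
          (M.toTwoNFA (a * Nat.log 2 x.length + b)).Accepts x ↔ x ∈ P.yes := fun x =>
        (NTM.toTwoNFA_accepts_iff (hS x)).trans (hM x).symm
      refine ⟨p, fun n => M.toTwoNFA (a * Nat.log 2 n + b), fun n => ⟨?_, ?_, ?_⟩⟩
      · rw [NTM.card_toTwoNFA]
        exact hp n
      · rintro x ⟨rfl, hx⟩
        exact (hacc x).2 hx
      · rintro x ⟨rfl, hx⟩
        exact fun h => hx ((hacc x).1 h)
    · rw [Polynomial.eval_X]
      rcases hx with hx | hx <;> exact hx.1.le
  obtain ⟨p, N, hN⟩ := H hF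
  obtain ⟨a', b', hp⟩ := exists_eval_le_two_pow_log p
  have hfin := fun n => (N n).finite_state
  have hlab := fun n => exists_label (N n).start (w := a' * Nat.log 2 n + b')
    ((hN n).1.trans (hp n))
  choose lab h0 hz hinj using hlab
  have hlist : ∀ n, ∃ l : List (N n).State, (∀ q, q ∈ l) ∧ l.length = Nat.card (N n).State := by
    intro n
    have := Fintype.ofFinite (N n).State
    exact ⟨Finset.univ.toList, by simp, by simp [Nat.card_eq_fintype_card]⟩
  choose qs hqs hlen using hlist
  let h : ℕ → List (Code P.Alph) := fun n =>
    interp.advice (N n) (lab n) (a' * Nat.log 2 n + b') (qs n)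
  have hpos : ∀ x ∈ P.yes, ∃ T, (((N x.length).step x)^[T] ((N x.length).init x)).state ∈
      (N x.length).verdict true := fun x hx => (hN x.length).2.1 x ⟨rfl, hx⟩
  have hneg : ∀ x ∉ P.yes, ∃ T, (((N x.length).step x)^[T] ((N x.length).init x)).state ∈
      (N x.length).verdict false := fun x hx => (hN x.length).2.2 x ⟨rfl, hx⟩
  obtain ⟨p', hp'⟩ : PolyBounded fun n => (h n).length := by
    refine ((PolyBounded.eval p).mul (((PolyBounded.const 2).mul (((PolyBounded.const a').mul
      PolyBounded.log_two).add (PolyBounded.const b'))).add (PolyBounded.const 2))).mono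
        fun n => ?_
    simp only [h, interp.length_advice, hlen]
    exact Nat.mul_le_mul_right _ (hN n).1
  refine ⟨Code P.Alph, inferInstance, ⟨.cmp true⟩, interp P.Alph, h, p', hp',
    ⟨a', b', fun x t => ?_⟩, fun x hx => ?_, fun x hx => ?_⟩
  -- The space bound concerns all inputs; it follows from halting, which holds with one verdict or
  -- the other.
  · by_cases hx : x ∈ P.yes
    · obtain ⟨T, hT⟩ := hpos x hx
      exact (interp.correct (h0 _) (hz _) (hinj _) (hqs _) hT).2 t
    · obtain ⟨T, hT⟩ := hneg x hx
      exact (interp.correct (h0 _) (hz _) (hinj _) (hqs _) hT).2 t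
  · obtain ⟨T, hT⟩ := hpos x hx
    exact (interp.correct (h0 _) (hz _) (hinj _) (hqs _) hT).1
  · obtain ⟨T, hT⟩ := hneg x hx
    exact (interp.correct (h0 _) (hz _) (hinj _) (hqs _) hT).1

/-! ### Binary counters -/

/-- Increment of a binary number, least significant bit first. -/
def binInc : List Bool → List Bool
  | [] => [true]
  | false :: l => true :: l
  | true :: l => false :: binInc l

def binVal : List Bool → ℕ
  | [] => 0
  | b :: l => (if b then 1 else 0) + 2 * binVal l

theorem binVal_binInc (l : List Bool) : binVal (binInc l) = binVal l + 1 := by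
  induction l with
  | nil => rfl
  | cons b l ih =>
    rcases b with _ | _
    · simp [binInc, binVal]; omega
    · simp [binInc, binVal, ih]; omega

theorem binVal_lt (l : List Bool) : binVal l < 2 ^ l.length := by
  induction l with
  | nil => simp [binVal]
  | cons b l ih =>
    rw [List.length_cons, pow_succ, binVal]
    split_ifs <;> omega

theorem length_le_binInc (l : List Bool) : l.length ≤ (binInc l).length := by
  induction l with
  | nil => simp
  | cons b l ih =>
    rcases b with _ | _
    · simp [binInc]
    · simpa [binInc] using ih

/-- The inequality expresses that there are no leading zeros; the summand 1 in the hypothesis admits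
the empty list, and an incremented number is never empty. -/
theorem two_pow_length_binInc (l : List Bool) (h : 2 ^ l.length ≤ 2 * binVal l + 1) :
    2 ^ (binInc l).length ≤ 2 * binVal (binInc l) := by
  induction l with
  | nil => simp [binInc, binVal]
  | cons b l ih =>
    rw [List.length_cons, pow_succ, binVal] at h
    rcases b with _ | _
    · rw [if_neg (by simp)] at h
      simp only [binInc, binVal, List.length_cons, pow_succ, if_true]
      omega
    · rw [if_pos rfl] at h
      have := ih (by omega)
      simp only [binInc, binVal, List.length_cons, pow_succ, Bool.false_eq_true, if_false]
      omega

/-- The binary number `k`. -/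
def binNum (k : ℕ) : List Bool := binInc^[k] []

theorem binNum_succ (k : ℕ) : binNum (k + 1) = binInc (binNum k) :=
  Function.iterate_succ_apply' _ _ _

theorem binVal_binNum (k : ℕ) : binVal (binNum k) = k := by
  induction k with
  | zero => rfl
  | succ k ih => rw [binNum_succ, binVal_binInc, ih]

theorem lt_two_pow_length_binNum (k : ℕ) : k < 2 ^ (binNum k).length := by
  simpa [binVal_binNum] using binVal_lt (binNum k)

theorem two_pow_length_binNum (k : ℕ) : 2 ^ (binNum k).length ≤ 2 * k + 1 := by
  induction k with
  | zero => simp [binNum]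
  | succ k ih =>
    have h := two_pow_length_binInc (binNum k) (by rwa [binVal_binNum])
    rw [← binNum_succ, binVal_binNum] at h
    omega

theorem length_binNum_mono {j k : ℕ} (h : j ≤ k) : (binNum j).length ≤ (binNum k).length := by
  induction h with
  | refl => exact le_rfl
  | step _ ih => exact ih.trans (by rw [Nat.succ_eq_add_one, binNum_succ]; exact length_le_binInc _)

theorem length_binNum_le (n : ℕ) : (binNum (n + 2)).length ≤ Nat.log 2 n + 3 := by
  have h1 := two_pow_length_binNum (n + 2)
  have h2 : n < 2 ^ (Nat.log 2 n + 1) := Nat.lt_pow_succ_log_self one_lt_two n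
  have h3 : 2 ^ (Nat.log 2 n + 4) = 8 * 2 ^ (Nat.log 2 n + 1) := by
    rw [show Nat.log 2 n + 4 = Nat.log 2 n + 1 + 3 by omega, pow_add]; ring
  have h4 : 2 ≤ 2 ^ (Nat.log 2 n + 1) := by
    rw [pow_succ]; have := Nat.pos_of_ne_zero (pow_ne_zero (Nat.log 2 n) two_ne_zero); omega
  have : 2 ^ (binNum (n + 2)).length < 2 ^ (Nat.log 2 n + 4) := by omega
  have := (Nat.pow_lt_pow_iff_right one_lt_two).1 this
  omega

/-! ### Enforcing a logarithmic space bound -/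

/-- The marks on a work tape whose marked cells hold a binary number. -/
inductive Mark : Type where
  | blank
  | origin
  | digit (b : Bool)

instance : Finite Mark := by
  refine Finite.of_surjective
    (fun o : Option (Option Bool) => match o with
      | none => Mark.blank
      | some none => Mark.origin
      | some (some b) => Mark.digit b) ?_
  rintro (_ | _ | b)
  exacts [⟨none, rfl⟩, ⟨some none, rfl⟩, ⟨some (some b), rfl⟩]

def marks (l : List Bool) : ℕ → Mark
  | 0 => .origin
  | i + 1 => match l[i]? with
    | none => .blank
    | some b => .digit b

theorem marks_ne_blank_iff (l : List Bool) (i : ℕ) : marks l i ≠ .blank ↔ i ≤ l.length := by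
  rcases i with _ | i
  · simp [marks]
  · rcases h : l[i]? with _ | b
    · simp only [marks, h, ne_eq, not_true_eq_false, false_iff]
      rw [List.getElem?_eq_none_iff] at h
      omega
    · simp only [marks, h, ne_eq, reduceCtorEq, not_false_eq_true, true_iff]
      obtain ⟨h, -⟩ := List.getElem?_eq_some_iff.1 h
      omega

theorem marks_of_lt {l : List Bool} {i : ℕ} (h : i < l.length) :
    marks l (i + 1) = .digit l[i] := by
  simp [marks, h]

theorem marks_append_cons (j l : List Bool) (b : Bool) :
    marks (j ++ b :: l) (j.length + 1) = .digit b := by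
  simp [marks]

theorem marks_length (j : List Bool) : marks j (j.length + 1) = .blank := by
  simp [marks]

theorem update_marks (j l : List Bool) (b b' : Bool) :
    Function.update (marks (j ++ b :: l)) (j.length + 1) (.digit b') = marks (j ++ b' :: l) := by
  funext i
  rcases i with _ | i
  · simp [marks]
  · rw [Function.update_apply]
    split_ifs with h
    · obtain rfl : i = j.length := by omega
      simp [marks]
    · have : i ≠ j.length := by omega
      simp only [marks]
      rw [List.getElem?_append, List.getElem?_append]
      split_ifs with h'
      · rfl
      · obtain ⟨k, hk⟩ : ∃ k, i - j.length = k + 1 := ⟨i - j.length - 1, by omega⟩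
        rw [hk]
        rfl

theorem update_marks_nil (j : List Bool) (b : Bool) :
    Function.update (marks j) (j.length + 1) (.digit b) = marks (j ++ [b]) := by
  funext i
  rcases i with _ | i
  · simp [marks]
  · rw [Function.update_apply]
    split_ifs with h
    · obtain rfl : i = j.length := by omega
      simp [marks]
    · have : i ≠ j.length := by omega
      simp only [marks]
      rw [List.getElem?_append]
      split_ifs with h'
      · rfl
      · obtain ⟨k, hk⟩ : ∃ k, i - j.length = k + 1 := ⟨i - j.length - 1, by omega⟩
        rw [hk, List.getElem?_eq_none_iff.2 (by omega)]
        rfl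

inductive ClockState (Q : Type) : Type where
  | init
  | carry
  | back
  | sim (q : Q)

instance {Q : Type} [Finite Q] : Finite (ClockState Q) := by
  refine Finite.of_surjective
    (fun o : Option (Option (Option Q)) => match o with
      | none => ClockState.init
      | some none => ClockState.carry
      | some (some none) => ClockState.back
      | some (some (some q)) => ClockState.sim q) ?_
  rintro (_ | _ | _ | q)
  exacts [⟨none, rfl⟩, ⟨some none, rfl⟩, ⟨some (some none), rfl⟩, ⟨some (some (some q)), rfl⟩]

/-! ### The clocked machine: counting the tape cells, then simulating -/

namespace NTM

variable {A : Type} (M : NTM A)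

/-- Each input cell, endmarkers included, causes one increment: `carry` runs over the digits and
`back` returns to the origin mark. At the right endmarker the input head wraps around and the
simulation starts; it gets stuck on a cell with blank mark. -/
def clockTrans : ClockState M.State → Marked A → Mark × M.Work →
    Set (ClockState M.State × Dir × (Mark × M.Work) × Dir)
  | .init, _, (_, w) => {(.carry, .stay, (.origin, w), .right)}
  | .carry, _, (.digit true, w) => {(.carry, .stay, (.digit false, w), .right)}
  | .carry, _, (.digit false, w) => {(.back, .stay, (.digit true, w), .left)}
  | .carry, _, (.blank, w) => {(.back, .stay, (.digit true, w), .left)}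
  | .carry, _, (.origin, _) => ∅
  | .back, _, (.digit b, w) => {(.back, .stay, (.digit b, w), .left)}
  | .back, .rend, (.origin, w) => {(.sim M.start, .right, (.origin, w), .stay)}
  | .back, .lend, (.origin, w) => {(.carry, .right, (.origin, w), .right)}
  | .back, .letter _, (.origin, w) => {(.carry, .right, (.origin, w), .right)}
  | .back, _, (.blank, _) => ∅
  | .sim q, a, (m, w) => {r | m ≠ .blank ∧ ∃ t ∈ M.trans q a w,
      r = (.sim t.1, t.2.1, (m, t.2.2.1), t.2.2.2)}

/-- The machine that first writes the length of the tape in binary, and then simulates `M` as long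
as the work head stays on the cells used for this number. -/
abbrev clocked : NTM A where
  State := ClockState M.State
  finite_state := by
    have := M.finite_state
    infer_instance
  Work := Mark × M.Work
  finite_work := by
    have := M.finite_work
    infer_instance
  blank := (.blank, M.blank)
  start := .init
  acc := ClockState.sim '' M.acc
  rej := ClockState.sim '' M.rej
  disjoint_halt :=
    (Set.disjoint_image_iff fun _ _ h => by injection h).2 M.disjoint_halt
  trans := M.clockTrans

/-- One step within the cells `0, …, S` of the work tape. -/
def StepIn (S : ℕ) (x : List A) (c c' : M.Conf x) : Prop := M.Step x c c' ∧ c.workPos ≤ S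

def AcceptsIn (S : ℕ) (x : List A) : Prop :=
  ∃ c, Relation.ReflTransGen (M.StepIn S x) (M.init x) c ∧ c.state ∈ M.acc

namespace clocked

variable {M} {x : List A}

/-- The work tape with the number `l` on the marks and with the contents `g`. -/
abbrev tape (l : List Bool) (g : ℕ → M.Work) : ℕ → Mark × M.Work := fun i => (marks l i, g i)

theorem update_tape (f : ℕ → Mark) (g : ℕ → M.Work) (k : ℕ) (m : Mark) (a : M.Work) :
    Function.update (fun i => (f i, g i)) k (m, a) =
      fun i => (Function.update f k m i, Function.update g k a i) := by
  funext i
  by_cases h : i = k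
  · subst h; simp
  · simp [h]

theorem update_tape_left (f : ℕ → Mark) (g : ℕ → M.Work) (k : ℕ) (m : Mark) :
    Function.update (fun i => (f i, g i)) k (m, g k) = fun i => (Function.update f k m i, g i) := by
  rw [update_tape, Function.update_eq_self]

theorem update_tape_right (f : ℕ → Mark) (g : ℕ → M.Work) (k : ℕ) (a : M.Work) :
    Function.update (fun i => (f i, g i)) k (f k, a) =
      fun i => (f i, Function.update g k a i) := by
  rw [update_tape, Function.update_eq_self]

theorem not_mem_halt {s : ClockState M.State} (h : ∀ q, s ≠ .sim q) :
    s ∉ M.clocked.acc ∪ M.clocked.rej := by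
  rintro (⟨q, -, hq⟩ | ⟨q, -, hq⟩) <;> exact h q hq.symm

theorem sim_mem_halt_iff {q : M.State} :
    ClockState.sim q ∈ M.clocked.acc ∪ M.clocked.rej ↔ q ∈ M.acc ∪ M.rej := by
  constructor
  · rintro (⟨q', h, hq⟩ | ⟨q', h, hq⟩)
    · injection hq with hq
      exact .inl (hq ▸ h)
    · injection hq with hq
      exact .inr (hq ▸ h)
  · rintro (h | h)
    · exact .inl ⟨q, h, rfl⟩
    · exact .inr ⟨q, h, rfl⟩

theorem marks_nil : Function.update (fun _ => Mark.blank) 0 .origin = marks [] := by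
  funext i
  rcases i with _ | i <;> simp [marks]

/-- The counting phase is deterministic, so its steps can be computed as equivalences and used both
for the invariant and for reachability. -/
theorem step_iff_of_trans_eq {c c' : M.clocked.Conf x}
    {m : ClockState M.State × Dir × (Mark × M.Work) × Dir} (hh : ∀ q, c.state ≠ .sim q)
    (hm : M.clockTrans c.state (readCell x c.inPos) (c.work c.workPos) = {m}) :
    M.clocked.Step x c c' ↔ c' = ⟨m.1, m.2.1.moveCirc c.inPos, m.2.2.2.moveWork c.workPos,
      Function.update c.work c.workPos m.2.2.1⟩ := by
  constructor
  · rintro ⟨-, m', hm', rfl⟩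
    obtain rfl : m' = m := by
      have h : m' ∈ M.clockTrans c.state (readCell x c.inPos) (c.work c.workPos) := hm'
      rwa [hm] at h
    rfl
  · rintro rfl
    refine ⟨not_mem_halt hh, m, ?_, rfl⟩
    change m ∈ M.clockTrans c.state (readCell x c.inPos) (c.work c.workPos)
    rw [hm]
    rfl

/-- The configuration in which a carry has reached the digits `l`. -/
abbrev carryConf (p : Fin (x.length + 2)) (j : ℕ) (l : List Bool) : M.clocked.Conf x :=
  ⟨.carry, p, j + 1, tape (List.replicate j false ++ l) fun _ => M.blank⟩

/-- The configuration in which the head returns to the first cell after an increment. -/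
abbrev backConf (p : Fin (x.length + 2)) (k : ℕ) (l : List Bool) : M.clocked.Conf x :=
  ⟨.back, p, k, tape l fun _ => M.blank⟩

/-- The configuration of the clocked machine that simulates `c`. -/
abbrev simConf (l : List Bool) (c : M.Conf x) : M.clocked.Conf x :=
  ⟨.sim c.state, c.inPos, c.workPos, tape l c.work⟩

theorem step_init_iff {c' : M.clocked.Conf x} :
    M.clocked.Step x (M.clocked.init x) c' ↔ c' = carryConf 0 0 [] := by
  rw [step_iff_of_trans_eq (m := (.carry, .stay, (.origin, M.blank), .right)) (by simp [init]) rfl]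
  have h : Function.update (M.clocked.init x).work 0 (Mark.origin, M.blank) =
      tape [] fun _ => M.blank :=
    (update_tape_left (fun _ => Mark.blank) (fun _ => M.blank) 0 .origin).trans
      (by rw [marks_nil])
  exact Eq.congr_right (congrArg (fun f => (⟨.carry, 0, 1, f⟩ : M.clocked.Conf x)) h)

theorem step_carry_nil_iff {p : Fin (x.length + 2)} {j : ℕ} {c' : M.clocked.Conf x} :
    M.clocked.Step x (carryConf p j []) c' ↔
      c' = backConf p j (List.replicate j false ++ [true]) := by
  have h1 := marks_length (List.replicate j false)
  have h2 := update_marks_nil (List.replicate j false) true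
  rw [List.length_replicate] at h1 h2
  rw [step_iff_of_trans_eq (m := (.back, .stay, (.digit true, M.blank), .left)) (by simp)
    (by simp only [List.append_nil, tape, h1, clockTrans])]
  simp only [List.append_nil, update_tape_left, h2]
  rfl

theorem step_carry_false_iff {p : Fin (x.length + 2)} {j : ℕ} {l : List Bool}
    {c' : M.clocked.Conf x} : M.clocked.Step x (carryConf p j (false :: l)) c' ↔
      c' = backConf p j (List.replicate j false ++ true :: l) := by
  have h1 := marks_append_cons (List.replicate j false) l false
  have h2 := update_marks (List.replicate j false) l false true
  rw [List.length_replicate] at h1 h2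
  rw [step_iff_of_trans_eq (m := (.back, .stay, (.digit true, M.blank), .left)) (by simp)
    (by simp only [tape, h1, clockTrans])]
  simp only [update_tape_left, h2]
  rfl

theorem replicate_append_cons (j : ℕ) (l : List Bool) :
    List.replicate j false ++ false :: l = List.replicate (j + 1) false ++ l := by
  rw [List.replicate_succ', List.append_assoc]
  rfl

theorem step_carry_true_iff {p : Fin (x.length + 2)} {j : ℕ} {l : List Bool}
    {c' : M.clocked.Conf x} : M.clocked.Step x (carryConf p j (true :: l)) c' ↔
      c' = carryConf p (j + 1) l := by
  have h1 := marks_append_cons (List.replicate j false) l true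
  have h2 := update_marks (List.replicate j false) l true false
  rw [List.length_replicate] at h1 h2
  rw [step_iff_of_trans_eq (m := (.carry, .stay, (.digit false, M.blank), .right)) (by simp)
    (by simp only [tape, h1, clockTrans])]
  simp only [update_tape_left, h2, replicate_append_cons]
  rfl

theorem step_back_succ_iff {p : Fin (x.length + 2)} {k : ℕ} {l : List Bool} (hk : k < l.length)
    {c' : M.clocked.Conf x} : M.clocked.Step x (backConf p (k + 1) l) c' ↔
      c' = backConf p k l := by
  have h1 := marks_of_lt hk
  rw [step_iff_of_trans_eq (m := (.back, .stay, (.digit l[k], M.blank), .left)) (by simp)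
    (by simp only [tape, h1, clockTrans])]
  simp only [← h1, Function.update_eq_self]
  rfl

theorem step_back_zero_iff {p : Fin (x.length + 2)} {l : List Bool}
    (hp : (p : ℕ) ≠ x.length + 1) {c' : M.clocked.Conf x} :
    M.clocked.Step x (backConf p 0 l) c' ↔ c' = carryConf (p + 1) 0 l := by
  rw [step_iff_of_trans_eq (m := (.carry, .right, (marks l 0, M.blank), .right)) (by simp)]
  · simp only [Function.update_eq_self]
    rfl
  · rcases hs : readCell x p with _ | a | _
    · rfl
    · rfl
    · exact (hp (readCell_eq_rend_iff.1 hs)).elim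

theorem step_back_rend_iff {p : Fin (x.length + 2)} {l : List Bool}
    (hp : (p : ℕ) = x.length + 1) {c' : M.clocked.Conf x} :
    M.clocked.Step x (backConf p 0 l) c' ↔ c' = simConf l (M.init x) := by
  rw [step_iff_of_trans_eq (m := (.sim M.start, .right, (marks l 0, M.blank), .stay)) (by simp)]
  · simp only [Function.update_eq_self, Dir.moveCirc, add_one_eq_zero_of_eq hp]
    rfl
  · simp only [readCell_eq_rend_iff.2 hp]
    rfl

theorem step_sim_iff {l : List Bool} {c : M.Conf x} {c' : M.clocked.Conf x} :
    M.clocked.Step x (simConf l c) c' ↔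
      ∃ d, M.StepIn l.length x c d ∧ c' = simConf l d := by
  constructor
  · rintro ⟨hh, m, ⟨hm, t, ht, rfl⟩, rfl⟩
    refine ⟨_, ⟨⟨fun h => hh (sim_mem_halt_iff.2 h), t, ht, rfl⟩,
      (marks_ne_blank_iff _ _).1 hm⟩, ?_⟩
    simp only [update_tape_right]
  · rintro ⟨d, ⟨⟨hh, t, ht, rfl⟩, hp⟩, rfl⟩
    refine ⟨fun h => hh (sim_mem_halt_iff.1 h), (.sim t.1, t.2.1, (marks l c.workPos, t.2.2.1),
      t.2.2.2), ⟨(marks_ne_blank_iff _ _).2 hp, t, ht, rfl⟩, ?_⟩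
    simp only [update_tape_right]

/-- The number of the last cell on which the simulation is allowed. -/
def bound (x : List A) : ℕ := (binNum (x.length + 2)).length

/-- In `carry`, the first `j` digits were ones and are already cleared, and the increment is still
due on `l`. In `sim`, the head may be one cell beyond the marked ones, where the machine is stuck.
-/
inductive Inv (x : List A) : M.clocked.Conf x → Prop
  | init : Inv x (M.clocked.init x)
  | carry (p : Fin (x.length + 2)) (j : ℕ) (l : List Bool)
      (h : binNum (p + 1) = List.replicate j false ++ binInc l) : Inv x (carryConf p j l)
  | back (p : Fin (x.length + 2)) (k : ℕ) (hk : k ≤ (binNum (p + 1)).length) :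
      Inv x (backConf p k (binNum (p + 1)))
  | sim (c : M.Conf x) (hp : c.workPos ≤ bound x + 1)
      (h : Relation.ReflTransGen (M.StepIn (bound x) x) (M.init x) c) :
      Inv x (simConf (binNum (x.length + 2)) c)

theorem moveWork_le (d : Dir) (k : ℕ) : d.moveWork k ≤ k + 1 := by
  rcases d with _ | _ | _ <;> simp only [Dir.moveWork] <;> omega

theorem workPos_le_of_stepIn {S : ℕ} {c d : M.Conf x} (h : M.StepIn S x c d) :
    d.workPos ≤ S + 1 := by
  obtain ⟨⟨-, t, -, rfl⟩, hp⟩ := h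
  exact (moveWork_le _ _).trans (Nat.succ_le_succ hp)

theorem Inv.step {c c' : M.clocked.Conf x} (hc : Inv x c) (h : M.clocked.Step x c c') :
    Inv x c' := by
  cases hc with
  | init =>
    rw [step_init_iff.1 h]
    exact .carry 0 0 [] rfl
  | carry p j l hl =>
    rcases l with _ | ⟨_ | _, l⟩
    · rw [step_carry_nil_iff.1 h, show _ ++ [true] = _ from hl.symm]
      exact .back p j (by simp [hl])
    · rw [step_carry_false_iff.1 h, show _ ++ true :: l = _ from hl.symm]
      exact .back p j (by simp [hl])
    · rw [step_carry_true_iff.1 h]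
      exact .carry p (j + 1) l (hl.trans (replicate_append_cons j _))
  | back p k hk =>
    rcases k with _ | k
    · by_cases hp : (p : ℕ) = x.length + 1
      · rw [(step_back_rend_iff hp).1 h, hp]
        exact .sim _ (Nat.zero_le _) .refl
      · rw [(step_back_zero_iff hp).1 h]
        exact .carry _ _ _ (by rw [val_add_one_of_ne hp, binNum_succ (p + 1)]; rfl)
    · rw [(step_back_succ_iff hk).1 h]
      exact .back p k (by omega)
  | sim c hp hc =>
    obtain ⟨d, hd, rfl⟩ := step_sim_iff.1 h
    exact .sim d (workPos_le_of_stepIn hd) (hc.tail hd)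

theorem Inv.of_reachable {c : M.clocked.Conf x} (h : M.clocked.Reachable x c) : Inv x c := by
  induction h with
  | refl => exact .init
  | tail _ hs ih => exact ih.step hs

theorem Inv.workPos_le {c : M.clocked.Conf x} (h : Inv x c) : c.workPos ≤ bound x + 1 := by
  rw [bound]
  cases h with
  | init => exact Nat.zero_le _
  | carry p j l hl =>
    have h1 := length_binNum_mono (show (p : ℕ) + 1 ≤ x.length + 2 from p.2)
    rw [hl] at h1
    simp only [List.length_append, List.length_replicate] at h1
    simp only
    omega
  | back p k hk =>
    have h1 := length_binNum_mono (show (p : ℕ) + 1 ≤ x.length + 2 from p.2)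
    simp only
    omega
  | sim c hp => exact hp

theorem logSpace (M : NTM A) : M.clocked.LogSpace := by
  -- The constant 4 is 3 from `length_binNum_le` plus 1 for the cell beyond the digits.
  refine ⟨1, 4, fun x c hc => (Inv.of_reachable hc).workPos_le.trans ?_⟩
  have := length_binNum_le x.length
  rw [bound]
  omega

theorem reachable_back_of_carry {p : Fin (x.length + 2)} {l l' : List Bool} {j : ℕ}
    (hl : l' = List.replicate j false ++ binInc l)
    (hr : M.clocked.Reachable x (carryConf p j l)) :
    ∃ k ≤ l'.length, M.clocked.Reachable x (backConf p k l') := by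
  induction l generalizing j with
  | nil => exact ⟨j, by simp [hl], hl ▸ hr.tail (step_carry_nil_iff.2 rfl)⟩
  | cons b l ih =>
    rcases b with _ | _
    · exact ⟨j, by simp [hl], hl ▸ hr.tail (step_carry_false_iff.2 rfl)⟩
    · exact ih (hl.trans (replicate_append_cons j _)) (hr.tail (step_carry_true_iff.2 rfl))

theorem reachable_back_zero {p : Fin (x.length + 2)} {l : List Bool} {k : ℕ} (hk : k ≤ l.length)
    (hr : M.clocked.Reachable x (backConf p k l)) : M.clocked.Reachable x (backConf p 0 l) := by
  induction k with
  | zero => exact hr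
  | succ k ih => exact ih (by omega) (hr.tail ((step_back_succ_iff hk).2 rfl))

theorem reachable_back (k : ℕ) (p : Fin (x.length + 2)) (hp : (p : ℕ) = k) :
    M.clocked.Reachable x (backConf p 0 (binNum (k + 1))) := by
  have key : ∃ l, binNum (k + 1) = binInc l ∧ M.clocked.Reachable x (carryConf p 0 l) := by
    induction k generalizing p with
    | zero =>
      obtain rfl : p = 0 := Fin.ext hp
      exact ⟨[], rfl, .single (step_init_iff.2 rfl)⟩
    | succ k ih =>
      have hlt := p.2
      have hk : ((⟨k, by omega⟩ : Fin (x.length + 2)) : ℕ) ≠ x.length + 1 := by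
        simp only
        omega
      obtain ⟨l, hl, hr⟩ := ih ⟨k, by omega⟩ rfl
      obtain ⟨j, hj, hr⟩ := reachable_back_of_carry (j := 0) hl hr
      refine ⟨_, binNum_succ (k + 1),
        (reachable_back_zero hj hr).tail ((step_back_zero_iff hk).2 ?_)⟩
      exact congrArg (fun p => carryConf p 0 _) (Fin.ext (by rw [val_add_one_of_ne hk, hp]))
  obtain ⟨l, hl, hr⟩ := key
  obtain ⟨j, hj, hr⟩ := reachable_back_of_carry (j := 0) hl hr
  exact reachable_back_zero hj hr

/-- The invariant gives one direction; for the other, the counting phase really reaches the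
simulation, whose steps are exactly those of `StepIn`. -/
theorem accepts_iff : M.clocked.Accepts x ↔ M.AcceptsIn (bound x) x := by
  constructor
  · rintro ⟨c, hc, q, hq, hacc⟩
    cases Inv.of_reachable hc with
    | init => cases hacc
    | carry => cases hacc
    | back => cases hacc
    | sim c hp h =>
      injection hacc with hacc
      exact ⟨c, h, hacc ▸ hq⟩
  · rintro ⟨c, hc, hacc⟩
    refine ⟨simConf (binNum (x.length + 2)) c, ?_, c.state, hacc, rfl⟩
    clear hacc
    induction hc with
    | refl =>
      exact (reachable_back (x.length + 1) ⟨x.length + 1, by omega⟩ rfl).tail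
        ((step_back_rend_iff rfl).2 rfl)
    | tail _ hs ih => exact ih.tail (step_sim_iff.2 ⟨_, hs, rfl⟩)

theorem lt_two_pow_bound (x : List A) : x.length < 2 ^ bound x :=
  (Nat.lt_add_of_pos_right two_pos).trans (lt_two_pow_length_binNum (x.length + 2))

end clocked
end NTM
/-! ### A universal nondeterministic machine for reachability -/

/-- Instructions of the universal machine. An edge of a graph is written as a block: `enter`
(or `skip`, if the edge is switched off), comparisons with the label of its source, instructions
that write the label of its target, and `leave` (or `accept`). -/
inductive Instr : Type where
  | skip
  | enter
  | leave
  | accept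
  | cmp (b : Bool)
  | put (b : Bool)

instance : Finite Instr := by
  refine Finite.of_surjective
    (fun o : (Bool ⊕ Bool) ⊕ (Bool ⊕ Bool) => match o with
      | .inl (.inl b) => Instr.cmp b
      | .inl (.inr b) => Instr.put b
      | .inr (.inl true) => Instr.skip
      | .inr (.inl false) => Instr.enter
      | .inr (.inr true) => Instr.leave
      | .inr (.inr false) => Instr.accept) ?_
  rintro (_ | _ | _ | _ | b | b)
  exacts [⟨.inr (.inl true), rfl⟩, ⟨.inr (.inl false), rfl⟩, ⟨.inr (.inr true), rfl⟩,
    ⟨.inr (.inr false), rfl⟩, ⟨.inl (.inl b), rfl⟩, ⟨.inl (.inr b), rfl⟩]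

inductive Mode : Type where
  | idle
  | busy
  | done

instance : Finite Mode := by
  refine Finite.of_surjective
    (fun o : Option Bool => match o with
      | none => Mode.idle
      | some true => Mode.busy
      | some false => Mode.done) ?_
  rintro (_ | _ | _)
  exacts [⟨none, rfl⟩, ⟨some true, rfl⟩, ⟨some false, rfl⟩]

/-- The only nondeterministic choice is whether to enter a block marked `enter`. A failed comparison
kills the path, so nothing has to be undone. -/
def universalTrans : Mode → Marked Instr → Bool → Set (Mode × Dir × Bool × Dir)
  | .idle, a, s => {m | m = (.idle, .right, s, .stay) ∨
      a = .letter .enter ∧ m = (.busy, .right, s, .stay)}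
  | .busy, .letter (.cmp b), s => {m | s = b ∧ m = (.busy, .right, s, .right)}
  | .busy, .letter (.put b), _ => {(.busy, .right, b, .left)}
  | .busy, .letter .leave, s => {(.idle, .right, s, .stay)}
  | .busy, .letter .accept, s => {(.done, .right, s, .stay)}
  | _, _, _ => ∅

abbrev universal : NTM Instr where
  State := Mode
  finite_state := inferInstance
  Work := Bool
  finite_work := inferInstance
  blank := false
  start := .idle
  acc := {.done}
  rej := ∅
  disjoint_halt := by simp
  trans := universalTrans

theorem exists_drop_of_suffix {A : Type} {x : List A} {l : List (Marked A)}
    (h : l <:+ markedTape x) (hl : l ≠ []) :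
    ∃ i : Fin (x.length + 2), (markedTape x).drop i = l := by
  obtain ⟨t, ht⟩ := h
  have h1 := congrArg List.length ht
  rw [List.length_append, length_markedTape] at h1
  have := List.length_pos_of_ne_nil hl
  exact ⟨⟨t.length, by omega⟩, by simp [← ht]⟩

theorem suffix_of_suffix_append {α : Type} {a : α} {r b t : List α} (hb : a ∉ b)
    (h : a :: r <:+ b ++ t) : a :: r <:+ t := by
  induction b with
  | nil => exact h
  | cons c b ih =>
    rw [List.mem_cons, not_or] at hb
    rw [List.cons_append, List.suffix_cons_iff] at h
    rcases h with h | h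
    · exact (hb.1 (List.cons.inj h).1).elim
    · exact ih hb.2 h

/-! ### Runs of the universal machine through a list of edges -/

namespace universal

variable {y : List Instr} {S : ℕ}

/-- Comparisons with the bits `g k, …, g (k + m - 1)`. -/
def cmps (g : ℕ → Bool) : ℕ → ℕ → List Instr
  | _, 0 => []
  | k, m + 1 => .cmp (g k) :: cmps g (k + 1) m

/-- Instructions that write the bits `g k, …, g 0`. -/
def puts (g : ℕ → Bool) : ℕ → List Instr
  | 0 => [.put (g 0)]
  | k + 1 => .put (g (k + 1)) :: puts g k

theorem length_cmps (g : ℕ → Bool) (k m : ℕ) : (cmps g k m).length = m := by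
  induction m generalizing k with
  | zero => rfl
  | succ m ih => simp [cmps, ih]

theorem length_puts (g : ℕ → Bool) (k : ℕ) : (puts g k).length = k + 1 := by
  induction k with
  | zero => rfl
  | succ k ih => simp [puts, ih]

def IsPlain (i : Instr) : Prop := ∃ b, i = .cmp b ∨ i = .put b

theorem isPlain_of_mem_cmps {g : ℕ → Bool} {m k : ℕ} {i : Instr} (h : i ∈ cmps g k m) :
    IsPlain i := by
  induction m generalizing k with
  | zero => simp [cmps] at h
  | succ m ih =>
    rcases List.mem_cons.1 h with rfl | h
    · exact ⟨_, .inl rfl⟩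
    · exact ih h

theorem isPlain_of_mem_puts {g : ℕ → Bool} {k : ℕ} {i : Instr} (h : i ∈ puts g k) :
    IsPlain i := by
  induction k with
  | zero =>
    rcases List.mem_cons.1 h with rfl | h
    · exact ⟨_, .inr rfl⟩
    · simp at h
  | succ k ih =>
    rcases List.mem_cons.1 h with rfl | h
    · exact ⟨_, .inr rfl⟩
    · exact ih h

/-- The effect of a list of comparisons and write instructions, within the cells `0, …, S`. -/
def exec (S : ℕ) : List Instr → ℕ → (ℕ → Bool) → Option (ℕ × (ℕ → Bool))
  | [], k, f => some (k, f)
  | .cmp b :: l, k, f => if k ≤ S ∧ f k = b then exec S l (k + 1) f else none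
  | .put b :: l, k, f => if k ≤ S then exec S l (k - 1) (Function.update f k b) else none
  | _ :: _, _, _ => none

theorem exec_cmps (g : ℕ → Bool) (m : ℕ) {k : ℕ} {f : ℕ → Bool} (l : List Instr)
    (hk : k + m ≤ S + 1) [Decidable (∀ j, k ≤ j → j < k + m → f j = g j)] :
    exec S (cmps g k m ++ l) k f =
      if ∀ j, k ≤ j → j < k + m → f j = g j then exec S l (k + m) f else none := by
  classical
  induction m generalizing k with
  | zero =>
    rw [if_pos fun j h1 h2 => by omega]
    rfl
  | succ m ih =>
    rw [cmps, List.cons_append, exec, ih (by omega), ← ite_and,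
      show k + 1 + m = k + (m + 1) by omega]
    refine if_congr ⟨fun h j h1 h2 => ?_, fun h => ⟨⟨by omega, h k le_rfl (by omega)⟩,
      fun j h1 h2 => h j (by omega) h2⟩⟩ rfl rfl
    rcases h1.eq_or_lt with rfl | h1
    · exact h.1.2
    · exact h.2 j h1 h2

theorem exec_puts (g : ℕ → Bool) {k : ℕ} {f : ℕ → Bool} (hk : k ≤ S) :
    exec S (puts g k) k f = some (0, fun j => if j ≤ k then g j else f j) := by
  induction k generalizing f with
  | zero =>
    simp only [puts, exec, hk, if_true, Option.some.injEq, Prod.mk.injEq, true_and]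
    funext j
    by_cases hj : j = 0
    · subst hj; simp
    · simp [hj]
  | succ k ih =>
    rw [puts, exec, if_pos hk, Nat.add_sub_cancel, ih (by omega)]
    simp only [Option.some.injEq, Prod.mk.injEq, true_and]
    funext j
    by_cases hj : j ≤ k
    · simp [hj, Nat.le_succ_of_le hj]
    · by_cases hj' : j = k + 1
      · subst hj'; simp
      · simp [hj, hj', show ¬ j ≤ k + 1 by omega]

theorem busy_not_mem : Mode.busy ∉ universal.acc ∪ universal.rej := by
  rintro (h | h) <;> cases h

theorem idle_not_mem : Mode.idle ∉ universal.acc ∪ universal.rej := by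
  rintro (h | h) <;> cases h

theorem exec_of_stepIn {p : Fin (y.length + 2)} {k : ℕ} {f : ℕ → Bool} {i : Instr}
    (hi : IsPlain i) (hp : readCell y p = .letter i) {c : universal.Conf y}
    (h : universal.StepIn S y ⟨.busy, p, k, f⟩ c) :
    ∃ k' f', c = ⟨.busy, p + 1, k', f'⟩ ∧ ∀ l, exec S (i :: l) k f = exec S l k' f' := by
  obtain ⟨⟨-, m, hm, rfl⟩, hk⟩ := h
  obtain ⟨b, rfl | rfl⟩ := hi
  · simp only [hp] at hm
    obtain ⟨hb, rfl⟩ := hm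
    refine ⟨k + 1, f, ?_, fun l => by rw [exec, if_pos ⟨hk, hb⟩]⟩
    simp only [Function.update_eq_self]
    rfl
  · simp only [hp] at hm
    obtain rfl : m = (.busy, .right, b, .left) := hm
    exact ⟨k - 1, _, rfl, fun l => by rw [exec, if_pos hk]⟩

theorem exists_stepIn_of_exec {p : Fin (y.length + 2)} {k : ℕ} {f : ℕ → Bool} {i : Instr}
    (hi : IsPlain i) (hp : readCell y p = .letter i) {l : List Instr} {res : ℕ × (ℕ → Bool)}
    (h : exec S (i :: l) k f = some res) :
    ∃ k' f', universal.StepIn S y ⟨.busy, p, k, f⟩ ⟨.busy, p + 1, k', f'⟩ ∧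
      exec S l k' f' = some res := by
  obtain ⟨b, rfl | rfl⟩ := hi
  · rw [exec] at h
    split_ifs at h with hkb
    refine ⟨k + 1, f, ⟨⟨busy_not_mem, (.busy, .right, f k, .right), ?_, ?_⟩, hkb.1⟩, h⟩
    · simp only [hp]
      exact ⟨hkb.2, rfl⟩
    · simp only [Function.update_eq_self]
      rfl
  · rw [exec] at h
    split_ifs at h with hk
    refine ⟨k - 1, _, ⟨⟨busy_not_mem, (.busy, .right, b, .left), ?_, rfl⟩, hk⟩, h⟩
    simp only [hp]
    rfl

theorem path_of_exec {l : List Instr} (hl : ∀ i ∈ l, IsPlain i) {p : Fin (y.length + 2)} {k : ℕ}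
    {f : ℕ → Bool} {r : List (Marked Instr)} (hr : r ≠ [])
    (hp : (markedTape y).drop p = l.map Marked.letter ++ r) {res : ℕ × (ℕ → Bool)}
    (h : exec S l k f = some res) :
    ∃ p' : Fin (y.length + 2), (markedTape y).drop p' = r ∧
      Relation.ReflTransGen (universal.StepIn S y) ⟨.busy, p, k, f⟩
        ⟨.busy, p', res.1, res.2⟩ := by
  induction l generalizing p k f with
  | nil =>
    obtain rfl := Option.some.inj h
    exact ⟨p, hp, .refl⟩
  | cons i l ih =>
    rw [List.map_cons, List.cons_append] at hp
    obtain ⟨k', f', hs, h'⟩ := exists_stepIn_of_exec (hl i List.mem_cons_self)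
      (readCell_of_drop hp) h
    obtain ⟨p', hp', hpath⟩ := ih (fun j hj => hl j (List.mem_cons_of_mem _ hj))
      (drop_add_one hp (by simp [hr])) h'
    exact ⟨p', hp', hpath.head hs⟩

/-! The encoding of a graph. -/

variable {V : Type} (lab : V → ℕ → Bool) (w : ℕ) (v₀ : V)

/-- The instructions for the edge from `e.1` to the vertex `e.2`; the value `none` of `e.2` stands
for acceptance in `e.1`. -/
def body (e : V × Option V) : List Instr :=
  cmps (lab e.1) 0 w ++ puts (lab (e.2.getD e.1)) w

def last (e : V × Option V) : Instr := if e.2.isSome then .leave else .accept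

open Classical in
-- Only the first letter depends on `act`; the rest of the list is the same for all inputs.
noncomputable def block (act : V × Option V → Prop) (e : V × Option V) : List Instr :=
  (if act e then .enter else .skip) :: (body lab w e ++ [last e])

variable {lab w v₀}

theorem isPlain_of_mem_body {e : V × Option V} {i : Instr} (h : i ∈ body lab w e) : IsPlain i :=
  (List.mem_append.1 h).elim isPlain_of_mem_cmps isPlain_of_mem_puts

/-- The body works as a test for the source followed by a jump to the target; an accepting edge
rewrites the label of its own source. -/
theorem exec_body (hw : w ≤ S) (hz : ∀ v j, w ≤ j → lab v j = false)
    (hinj : ∀ u v, (∀ j < w, lab u j = lab v j) → u = v) (e : V × Option V) (v : V)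
    [Decidable (v = e.1)] :
    exec S (body lab w e) 0 (lab v) =
      if v = e.1 then some (0, lab (e.2.getD e.1)) else none := by
  classical
  rw [body, exec_cmps _ _ _ (by omega), zero_add, exec_puts _ hw]
  refine if_congr ⟨fun h => hinj _ _ fun j hj => h j (Nat.zero_le _) hj,
    fun h j _ _ => by rw [h]⟩ ?_ rfl
  simp only [Option.some.injEq, Prod.mk.injEq, true_and]
  funext j
  split_ifs with hj
  · rfl
  · rw [hz _ j (by omega), hz _ j (by omega)]

variable {act : V × Option V → Prop} {es : List (V × Option V)}

theorem enter_not_mem (e : V × Option V) :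
    Marked.letter Instr.enter ∉ (body lab w e ++ [last e]).map Marked.letter := by
  intro h
  obtain ⟨i, hi, h⟩ := List.mem_map.1 h
  obtain rfl : i = .enter := by injection h
  rcases List.mem_append.1 hi with hi | hi
  · obtain ⟨b, hb | hb⟩ := isPlain_of_mem_body hi <;> cases hb
  · have := List.mem_singleton.1 hi
    unfold last at this
    split_ifs at this

/-- The letter `enter` occurs only at the head of a block, and only for an active edge. Hence a
guess of the machine always starts a genuine edge. -/
theorem exists_block_of_suffix {r : List (Marked Instr)}
    (h : .letter .enter :: r <:+
      (es.flatMap (block lab w act)).map Marked.letter ++ [Marked.rend]) :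
    ∃ e, act e ∧ ∃ r', r' ≠ [] ∧
      r = (body lab w e).map Marked.letter ++ .letter (last e) :: r' := by
  induction es with
  | nil =>
    simp [List.suffix_cons_iff] at h
  | cons e es ih =>
    rw [List.flatMap_cons, List.map_append, List.append_assoc, block, List.map_cons,
      List.cons_append, List.suffix_cons_iff] at h
    rcases h with h | h
    · obtain ⟨h1, h2⟩ := List.cons.inj h
      refine ⟨e, ?_, (es.flatMap (block lab w act)).map Marked.letter ++ [Marked.rend], ?_, ?_⟩
      · by_contra hne
        rw [if_neg hne] at h1
        cases h1
      · simp
      · rw [h2]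
        simp
    · exact ih (suffix_of_suffix_append (enter_not_mem e) h)

/-- Vertices reachable along active edges. -/
def Reach (act : V × Option V → Prop) (v₀ : V) (v : V) : Prop :=
  Relation.ReflTransGen (fun u v => act (u, some v)) v₀ v

variable (lab v₀ act) in
-- Inside a block nothing is claimed about the past; the condition is on the future: if the
-- remaining instructions succeed, the source was reachable and the tape will hold the target. The
-- case `done` allows any configuration, as the goal is then already met.
inductive Inv (S : ℕ) (y : List Instr) : universal.Conf y → Prop
  | idle (p : Fin (y.length + 2)) (v : V) (h : Reach act v₀ v) : Inv S y ⟨.idle, p, 0, lab v⟩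
  | busy (p : Fin (y.length + 2)) (k : ℕ) (f : ℕ → Bool) (l : List Instr) (e : V × Option V)
      (r : List (Marked Instr)) (hr : r ≠ [])
      (hp : (markedTape y).drop p = l.map Marked.letter ++ .letter (last e) :: r)
      (hl : ∀ i ∈ l, IsPlain i) (he : act e)
      (h : ∀ res, exec S l k f = some res → Reach act v₀ e.1 ∧ res = (0, lab (e.2.getD e.1))) :
      Inv S y ⟨.busy, p, k, f⟩
  | done (c : universal.Conf y) (h : ∃ v, Reach act v₀ v ∧ act (v, none)) : Inv S y c

theorem Inv.step (hw : w ≤ S) (hz : ∀ v j, w ≤ j → lab v j = false)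
    (hinj : ∀ u v, (∀ j < w, lab u j = lab v j) → u = v)
    (hy : y = es.flatMap (block lab w act)) {c c' : universal.Conf y}
    (hc : Inv lab v₀ act S y c) (h : universal.StepIn S y c c') :
    Inv lab v₀ act S y c' := by
  classical
  cases hc with
  | done _ hd => exact .done _ hd
  | idle p v hv =>
    obtain ⟨⟨-, m, hm, rfl⟩, -⟩ := h
    rcases hm with rfl | ⟨hs, rfl⟩
    · simp only [Function.update_eq_self]
      exact .idle _ v hv
    · simp only at hs
      have hd : (markedTape y).drop p = .letter .enter :: (markedTape y).drop (p + 1) := by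
        rw [← hs]
        exact List.drop_eq_getElem_cons (by rw [length_markedTape]; exact p.2)
      have hsuf := List.drop_suffix p (markedTape y)
      generalize (markedTape y).drop (p + 1) = l at hd
      rw [hd, markedTape, List.suffix_cons_iff, hy] at hsuf
      obtain ⟨e, he, r, hr, rfl⟩ := exists_block_of_suffix
        (hsuf.resolve_left fun h => by cases (List.cons.inj h).1)
      simp only [Function.update_eq_self]
      refine .busy (p + 1) 0 (lab v) _ e r hr (drop_add_one hd (by simp))
        (fun i hi => isPlain_of_mem_body hi) he fun res hres => ?_
      rw [exec_body hw hz hinj] at hres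
      split_ifs at hres with hve
      exact ⟨hve ▸ hv, (Option.some.inj hres).symm⟩
  | busy p k f l e r hr hp hl he hex =>
    rcases l with _ | ⟨i, l⟩
    -- With no instruction left, `exec` succeeds trivially and the conditional claim becomes
    -- unconditional.
    · obtain ⟨hreach, hres⟩ := hex _ rfl
      obtain ⟨rfl, rfl⟩ := Prod.mk.inj hres
      obtain ⟨⟨-, m, hm, rfl⟩, -⟩ := h
      have hs := readCell_of_drop hp
      obtain ⟨u, _ | v⟩ := e
      · exact .done _ ⟨u, hreach, he⟩
      · simp only [hs] at hm
        obtain rfl : m = (.idle, .right, lab v 0, .stay) := hm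
        simp only [Option.getD_some, Function.update_eq_self]
        exact .idle _ v (hreach.tail he)
    · rw [List.map_cons, List.cons_append] at hp
      obtain ⟨k', f', rfl, hk⟩ := exec_of_stepIn (hl i List.mem_cons_self) (readCell_of_drop hp) h
      exact .busy _ _ _ l e r hr (drop_add_one hp (by simp))
        (fun j hj => hl j (List.mem_cons_of_mem _ hj)) he fun res hres => hex res (hk l ▸ hres)

theorem reach_of_acceptsIn (hw : w ≤ S) (h0 : lab v₀ = fun _ => false)
    (hz : ∀ v j, w ≤ j → lab v j = false)
    (hinj : ∀ u v, (∀ j < w, lab u j = lab v j) → u = v)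
    (hy : y = es.flatMap (block lab w act)) (h : universal.AcceptsIn S y) :
    ∃ v, Reach act v₀ v ∧ act (v, none) := by
  obtain ⟨c, hc, hacc⟩ := h
  have : Inv lab v₀ act S y c := by
    clear hacc
    induction hc with
    | refl =>
      have := Inv.idle (lab := lab) (act := act) (S := S) (y := y) 0 v₀ .refl
      rwa [h0] at this
    | tail _ hs ih => exact ih.step hw hz hinj hy hs
  cases this with
  | idle => cases hacc
  | busy => cases hacc
  | done _ h => exact h

theorem idle_step (p : Fin (y.length + 2)) (f : ℕ → Bool) :
    universal.StepIn S y ⟨.idle, p, 0, f⟩ ⟨.idle, p + 1, 0, f⟩ := by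
  refine ⟨⟨idle_not_mem, (.idle, .right, f 0, .stay), .inl rfl, ?_⟩, Nat.zero_le _⟩
  simp only [Function.update_eq_self]
  rfl

theorem exists_iterate_add_one {n : ℕ} (p q : Fin (n + 2)) : ∃ k, (· + 1)^[k] p = q := by
  have key : ∀ k (h : k < n + 2), k • (1 : Fin (n + 2)) = ⟨k, h⟩ := by
    intro k
    induction k with
    | zero => intro h; rw [zero_nsmul]; rfl
    | succ k ih =>
      intro h
      rw [succ_nsmul, ih (by omega)]
      exact Fin.ext (val_add_one_of_ne (by simp only; omega))
  refine ⟨(q - p : Fin (n + 2)), ?_⟩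
  rw [add_right_iterate, key _ (q - p).2, Fin.eta]
  exact add_sub_cancel p q

/-- The input tape is circular, so moving right while keeping the label leads to every block,
whatever the order of the edges. -/
theorem idle_path (p q : Fin (y.length + 2)) (f : ℕ → Bool) :
    Relation.ReflTransGen (universal.StepIn S y) ⟨.idle, p, 0, f⟩ ⟨.idle, q, 0, f⟩ := by
  obtain ⟨k, rfl⟩ := exists_iterate_add_one p q
  induction k with
  | zero => exact .refl
  | succ k ih =>
    rw [Function.iterate_succ_apply']
    exact ih.tail (idle_step _ f)

/-- The machine can run through the block of an active edge up to its last instruction. -/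
theorem path_to_last (hw : w ≤ S) (hz : ∀ v j, w ≤ j → lab v j = false)
    (hinj : ∀ u v, (∀ j < w, lab u j = lab v j) → u = v) (hes : ∀ e, e ∈ es)
    (hy : y = es.flatMap (block lab w act)) (e : V × Option V) (he : act e)
    (p : Fin (y.length + 2)) :
    ∃ q : Fin (y.length + 2), readCell y q = .letter (last e) ∧
      Relation.ReflTransGen (universal.StepIn S y) ⟨.idle, p, 0, lab e.1⟩
        ⟨.busy, q, 0, lab (e.2.getD e.1)⟩ := by
  classical
  obtain ⟨es₁, es₂, rfl⟩ := List.append_of_mem (hes e)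
  have hsuf : .letter .enter :: ((body lab w e).map Marked.letter ++ (.letter (last e) ::
      ((es₂.flatMap (block lab w act)).map Marked.letter ++ [Marked.rend]))) <:+
        markedTape y := by
    refine ⟨.lend :: (es₁.flatMap (block lab w act)).map Marked.letter, ?_⟩
    simp [hy, markedTape, block, he]
  obtain ⟨q, hq⟩ := exists_drop_of_suffix hsuf (by simp)
  have hexec := exec_body hw hz hinj e e.1
  rw [if_pos rfl] at hexec
  obtain ⟨q', hq', hpath⟩ := path_of_exec (fun i hi => isPlain_of_mem_body hi) (by simp)
    (drop_add_one hq (by simp)) hexec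
  refine ⟨q', readCell_of_drop hq', (idle_path p q _).trans (hpath.head ?_)⟩
  refine ⟨⟨idle_not_mem, (.busy, .right, lab e.1 0, .stay),
    .inr ⟨readCell_of_drop hq, rfl⟩, ?_⟩, Nat.zero_le _⟩
  simp only [Function.update_eq_self]
  rfl

theorem acceptsIn_of_reach (hw : w ≤ S) (h0 : lab v₀ = fun _ => false)
    (hz : ∀ v j, w ≤ j → lab v j = false)
    (hinj : ∀ u v, (∀ j < w, lab u j = lab v j) → u = v) (hes : ∀ e, e ∈ es)
    (hy : y = es.flatMap (block lab w act)) {v : V} (hv : Reach act v₀ v) (ha : act (v, none)) :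
    universal.AcceptsIn S y := by
  have key : ∃ p, Relation.ReflTransGen (universal.StepIn S y) (universal.init y)
      ⟨.idle, p, 0, lab v⟩ := by
    clear ha
    induction hv with
    | refl => exact ⟨0, h0 ▸ .refl⟩
    | @tail u v _ he ih =>
      obtain ⟨p, hp⟩ := ih
      obtain ⟨q, hq, hpath⟩ := path_to_last hw hz hinj hes hy (u, some v) he p
      refine ⟨q + 1, (hp.trans hpath).tail
        ⟨⟨busy_not_mem, (.idle, .right, lab v 0, .stay), ?_, ?_⟩, Nat.zero_le _⟩⟩
      · simp only [hq]
        rfl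
      · simp only [Option.getD_some, Function.update_eq_self]
        rfl
  obtain ⟨p, hp⟩ := key
  obtain ⟨q, hq, hpath⟩ := path_to_last hw hz hinj hes hy (v, none) ha p
  refine ⟨_, (hp.trans hpath).tail
    ⟨⟨busy_not_mem, (.done, .right, lab v 0, .stay), ?_, rfl⟩, Nat.zero_le _⟩, rfl⟩
  simp only [hq]
  rfl

end universal
/-! ### Simulating a machine with advice on inputs that are computed cell by cell -/

def Marked.map {A B : Type} (f : A → B) : Marked A → Marked B
  | .lend => .lend
  | .letter a => .letter (f a)
  | .rend => .rend

theorem markedTape_map {A B : Type} (f : A → B) (x : List A) :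
    markedTape (x.map f) = (markedTape x).map (Marked.map f) := by
  simp [markedTape, Marked.map]

theorem readCell_map {A B : Type} (f : A → B) (x : List A) (i : Fin ((x.map f).length + 2)) :
    readCell (x.map f) i = (readCell x (i.cast (by rw [List.length_map]))).map f := by
  have h1 := getElem?_markedTape (x.map f) i
  have h2 := getElem?_markedTape x (i.cast (by rw [List.length_map]))
  rw [markedTape_map, List.getElem?_map] at h1
  rw [Fin.val_cast] at h2
  rw [h2] at h1
  exact (Option.some.inj h1).symm

theorem moveCirc_cast {m n : ℕ} (h : m = n) (d : Dir) (i : Fin (m + 2)) :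
    (d.moveCirc i).cast (by rw [h]) = d.moveCirc (i.cast (by rw [h]) : Fin (n + 2)) := by
  subst h
  rfl

section Sweep

variable {A C B τ : Type} (D : AdvisedDTM C B) (w : List B) (S R : ℕ) (T : List τ) (κ : τ → ℕ)
  (φ : τ → ℕ → Option (Marked A) → C)

/-- The string computed from `x` by the template `T`: the letter for `t` depends on the length of
`x` and on the contents of the cell `κ t`. -/
def fill (x : List A) : List C := T.map fun t => φ t x.length (markedTape x)[κ t]?

theorem length_fill (x : List A) : (fill T κ φ x).length = T.length := List.length_map _

namespace sweep

/-- Configurations of `D` on inputs of the length of `T`, with bounded work tape. -/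
abbrev SimConf : Type := D.State × Fin (T.length + 2) × Fin (w.length + 2) × Store D.Work S

/-- The cell of `x` that determines the cell `i` of the computed string. -/
def cellOf (i : Fin (T.length + 2)) : ℕ :=
  match readCell T i with
  | .letter t => κ t
  | _ => 0

variable {D w S T} in
def simStep (n : ℕ) (s : Option (Marked A)) (c : SimConf D w S T) : SimConf D w S T :=
  let m := D.trans c.1 ((readCell T c.2.1).map fun t => φ t n s) (readCell w c.2.2.1) c.2.2.2.read
  (m.1, m.2.1.moveCirc c.2.1, m.2.2.1.moveCirc c.2.2.1, c.2.2.2.write m.2.2.2.1 m.2.2.2.2)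

variable {D w S R T} in
/-- The head sweeps over the input; the states count the cells and remember the contents of the
relevant cell, and at the right endmarker one step of `D` is simulated. -/
def trans (q : SimConf D w S T × Fin (R + 2) × Option (Marked A)) (a : Marked A) :
    (SimConf D w S T × Fin (R + 2) × Option (Marked A)) × Dir :=
  let s := if (q.2.1 : ℕ) = cellOf T κ q.1.2.1 then some a else q.2.2
  match a with
  -- At the right endmarker the counter is the input length plus one, as long as the length is at
  -- most `R`.
  | .rend => ((simStep φ (q.2.1 - 1) s q.1, 0, none), .right)
  | _ => ((q.1, ⟨min (q.2.1 + 1) (R + 1), Nat.lt_succ_of_le (min_le_right _ _)⟩, s), .right)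

/-- The two-way automaton that simulates `D` with advice `w` on the string computed from its
input. -/
abbrev automaton [Finite A] : TwoDFA A where
  State := SimConf D w S T × Fin (R + 2) × Option (Marked A)
  finite_state := by
    have := D.finite_state
    have := D.finite_work
    infer_instance
  start := ((D.start, 0, 0, Store.ofTape S 0 fun _ => D.blank), 0, none)
  acc := {q | q.1.1 ∈ D.acc}
  rej := {q | q.1.1 ∈ D.rej}
  disjoint_halt := Set.disjoint_left.2 fun _ h h' => Set.disjoint_left.1 D.disjoint_halt h h'
  trans := trans κ φ

theorem card_automaton [Finite A] : Nat.card (automaton D w S R T κ φ).State =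
    Nat.card D.State * ((T.length + 2) * ((w.length + 2) * Nat.card (Store D.Work S))) *
      ((R + 2) * Nat.card (Option (Marked A))) := by
  simp only [Nat.card_prod, Nat.card_fin]

variable {D w S R T κ φ} {x : List A}

def proj (c : D.Conf (fill T κ φ x) w) : SimConf D w S T :=
  (c.state, c.inPos.cast (by rw [length_fill]), c.advPos, Store.ofTape S c.workPos c.work)

/-- One cell of `x` determines the symbol that `D` reads; on the endmarkers of the computed string
the default cell 0 has no influence. -/
theorem simStep_proj {c : D.Conf (fill T κ φ x) w} (hc : c.workPos ≤ S)
    (hh : c.state ∉ D.acc ∪ D.rej) :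
    simStep φ x.length (markedTape x)[cellOf T κ (proj (S := S) c).2.1]? (proj (S := S) c) =
      proj (D.step _ w c) := by
  have hread : (readCell T (proj (S := S) c).2.1).map (fun t => φ t x.length
      (markedTape x)[cellOf T κ (proj (S := S) c).2.1]?) = readCell (fill T κ φ x) c.inPos := by
    refine Eq.trans ?_ (readCell_map _ T c.inPos).symm
    have h : (fill T κ φ x).length + 2 = T.length + 2 := by rw [length_fill]
    simp only [cellOf, proj]
    change Marked.map _ (readCell T (c.inPos.cast h)) = Marked.map _ (readCell T (c.inPos.cast h))
    generalize readCell T (c.inPos.cast h) = s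
    rcases s with _ | t | _ <;> rfl
  rw [simStep, hread, AdvisedDTM.step, if_neg hh]
  simp only [proj, Store.read_ofTape hc, Store.write_ofTape hc,
    moveCirc_cast (length_fill T κ φ x)]

variable [Finite A]

/-- In the middle of a sweep the relevant cell is remembered exactly if it has been passed; `hx`
keeps the counter below its cap. -/
theorem iterate_step (hx : x.length ≤ R) (d : SimConf D w S T) (hd : d.1 ∉ D.acc ∪ D.rej) (m : ℕ)
    (hm : m < x.length + 2) :
    ((automaton D w S R T κ φ).step x)^[m] ⟨(d, 0, none), 0⟩ = ⟨(d, ⟨m, by omega⟩,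
      if cellOf T κ d.2.1 < m then (markedTape x)[cellOf T κ d.2.1]? else none), ⟨m, hm⟩⟩ := by
  induction m with
  | zero => rfl
  | succ m ih =>
    have hne : (⟨m, by omega⟩ : Fin (x.length + 2)).val ≠ x.length + 1 := by
      simp only
      omega
    have hr := mt readCell_eq_rend_iff.1 hne
    have hs := getElem?_markedTape x ⟨m, by omega⟩
    have hpos : (⟨m, by omega⟩ : Fin (x.length + 2)) + 1 = ⟨m + 1, hm⟩ :=
      Fin.ext (val_add_one_of_ne hne)
    rw [Function.iterate_succ_apply', ih (by omega), TwoDFA.step, if_neg (by exact hd)]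
    have ht : trans κ φ (d, (⟨m, by omega⟩ : Fin (R + 2)),
        if cellOf T κ d.2.1 < m then (markedTape x)[cellOf T κ d.2.1]? else none)
        (readCell x ⟨m, by omega⟩) = ((d, ⟨m + 1, by omega⟩,
        if cellOf T κ d.2.1 < m + 1 then (markedTape x)[cellOf T κ d.2.1]? else none), .right) := by
      have hmin : (⟨min (m + 1) (R + 1), Nat.lt_succ_of_le (min_le_right _ _)⟩ : Fin (R + 2)) =
          ⟨m + 1, by omega⟩ := Fin.ext (min_eq_left (by omega))
      have hif : (if m = cellOf T κ d.2.1 then some (readCell x ⟨m, by omega⟩) else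
          if cellOf T κ d.2.1 < m then (markedTape x)[cellOf T κ d.2.1]? else none) =
          if cellOf T κ d.2.1 < m + 1 then (markedTape x)[cellOf T κ d.2.1]? else none := by
        rw [← hs]
        rcases lt_trichotomy (cellOf T κ d.2.1) m with h | h | h
        · rw [if_neg (by omega), if_pos h, if_pos (by omega)]
        · rw [if_pos h.symm, if_pos (by omega)]
          simp only [h]
        · rw [if_neg (by omega), if_neg (by omega), if_neg (by omega)]
      rw [trans]
      · simp only [hif, hmin]
      · exact hr
    simp only [ht, Dir.moveCirc, hpos]

theorem exists_iterate_step (hx : x.length ≤ R) {c : D.Conf (fill T κ φ x) w} (hc : c.workPos ≤ S)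
    (hh : c.state ∉ D.acc ∪ D.rej) :
    ((automaton D w S R T κ φ).step x)^[x.length + 2] ⟨(proj c, 0, none), 0⟩ =
      ⟨(proj (D.step _ w c), 0, none), 0⟩ := by
  have hlast : readCell x ⟨x.length + 1, by omega⟩ = Marked.rend := readCell_eq_rend_iff.2 rfl
  have hs := getElem?_markedTape x ⟨x.length + 1, by omega⟩
  have hpos : (⟨x.length + 1, by omega⟩ : Fin (x.length + 2)) + 1 = 0 :=
    add_one_eq_zero_of_eq rfl
  rw [Function.iterate_succ_apply', iterate_step hx (proj c) hh _ (by omega), TwoDFA.step,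
    if_neg (by exact hh)]
  have hif : (if x.length + 1 = cellOf T κ (proj (S := S) c).2.1 then some Marked.rend else
      if cellOf T κ (proj (S := S) c).2.1 < x.length + 1 then
        (markedTape x)[cellOf T κ (proj (S := S) c).2.1]? else none) =
      (markedTape x)[cellOf T κ (proj (S := S) c).2.1]? := by
    rw [hlast] at hs
    rw [← hs]
    rcases lt_trichotomy (cellOf T κ (proj (S := S) c).2.1) (x.length + 1) with h | h | h
    · rw [if_neg (by omega), if_pos h]
    · rw [if_pos h.symm]
      simp only [h]
    -- The template may refer to a cell beyond the end of `x`; then nothing was stored and the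
    -- lookup gives `none` as well.
    · rw [if_neg (by omega), if_neg (by omega), List.getElem?_eq_none]
      rw [length_markedTape]
      omega
  simp only [hlast, trans, hif, Nat.add_sub_cancel, simStep_proj hc hh, Dir.moveCirc, hpos]

theorem exists_iterate_eq_run (hx : x.length ≤ R)
    (hS : ∀ t, (D.run (fill T κ φ x) w t).workPos ≤ S) (t : ℕ) :
    ∃ m, ((automaton D w S R T κ φ).step x)^[m] ((automaton D w S R T κ φ).init x) =
      ⟨(proj (D.run (fill T κ φ x) w t), 0, none), 0⟩ := by
  induction t with
  | zero => exact ⟨0, rfl⟩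
  | succ t ih =>
    obtain ⟨m, hm⟩ := ih
    have hrun : D.run (fill T κ φ x) w (t + 1) = D.step _ w (D.run _ w t) :=
      Function.iterate_succ_apply' _ _ _
    by_cases hh : (D.run (fill T κ φ x) w t).state ∈ D.acc ∪ D.rej
    · exact ⟨m, by rw [hm, hrun, AdvisedDTM.step_of_mem hh]⟩
    · exact ⟨x.length + 2 + m, by
        rw [Function.iterate_add_apply, hm, hrun, exists_iterate_step hx (hS t) hh]⟩

theorem accepts (hx : x.length ≤ R) (hS : ∀ t, (D.run (fill T κ φ x) w t).workPos ≤ S)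
    (h : D.Accepts (fill T κ φ x) w) : (automaton D w S R T κ φ).Accepts x := by
  obtain ⟨t, ht⟩ := h
  obtain ⟨m, hm⟩ := exists_iterate_eq_run hx hS t
  exact ⟨m, by rw [hm]; exact ht⟩

theorem rejects (hx : x.length ≤ R) (hS : ∀ t, (D.run (fill T κ φ x) w t).workPos ≤ S)
    (h : D.Rejects (fill T κ φ x) w) : (automaton D w S R T κ φ).Rejects x := by
  obtain ⟨t, ht⟩ := h
  obtain ⟨m, hm⟩ := exists_iterate_eq_run hx hS t
  exact ⟨m, by rw [hm]; exact ht⟩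

end sweep

end Sweep

/-! ### Two-way nondeterministic automata as inputs of the universal machine -/

namespace TwoNFA

variable {A : Type} (M : TwoNFA A) (R : ℕ)

/-- Configurations on inputs of length at most `R`. -/
abbrev Vertex : Type := M.State × Fin (R + 2)

/-- The edges of the configuration graph on an input of length `n` with contents `s` of the cell in
the source of the edge. The edges to `none` mark the accepting configurations. -/
def Active (e : M.Vertex R × Option (M.Vertex R)) (n : ℕ) (s : Option (Marked A)) : Prop :=
  match e.2 with
  | none => e.1.1 ∈ M.acc
  | some v => e.1.1 ∉ M.acc ∪ M.rej ∧ ∃ a, s = some a ∧ ∃ m ∈ M.trans e.1.1 a, v.1 = m.1 ∧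
      ∃ h : (e.1.2 : ℕ) < n + 2, (v.2 : ℕ) = m.2.moveCirc (⟨e.1.2, h⟩ : Fin (n + 2))

/-- The edges of the configuration graph on `x`. -/
def ActiveOn (x : List A) (e : M.Vertex R × Option (M.Vertex R)) : Prop :=
  M.Active R e x.length (markedTape x)[(e.1.2 : ℕ)]?

variable {M R} {x : List A}

def toVertex (hx : x.length ≤ R) (c : TwoConf M.State x) : M.Vertex R :=
  (c.state, c.pos.castLE (by omega))

/-- Vertices allow positions up to `R + 1`, but moves wrap around at the actual length of `x`, so
edges from genuine configurations lead to genuine ones. -/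
theorem activeOn_iff (hx : x.length ≤ R) {c : TwoConf M.State x} {v : M.Vertex R} :
    M.ActiveOn R x (toVertex hx c, some v) ↔ ∃ c', M.Step x c c' ∧ toVertex hx c' = v := by
  have hs := getElem?_markedTape x c.pos
  constructor
  · rintro ⟨hh, a, ha, m, hm, h1, h, h2⟩
    obtain rfl : readCell x c.pos = a := Option.some.inj (hs.symm.trans ha)
    exact ⟨_, ⟨hh, m, hm, rfl⟩, Prod.ext h1.symm (Fin.ext h2.symm)⟩
  · rintro ⟨_, ⟨hh, m, hm, rfl⟩, rfl⟩
    exact ⟨hh, _, hs, m, hm, rfl, c.pos.2, rfl⟩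

theorem reach_iff_accepts (hx : x.length ≤ R) :
    (∃ v, universal.Reach (M.ActiveOn R x) (M.start, 0) v ∧ M.ActiveOn R x (v, none)) ↔
      M.Accepts x := by
  have h0 : toVertex hx (M.init x) = (M.start, 0) := rfl
  constructor
  · rintro ⟨v, hv, ha⟩
    have : ∃ c, Relation.ReflTransGen (M.Step x) (M.init x) c ∧ toVertex hx c = v := by
      clear ha
      induction hv with
      | refl => exact ⟨_, .refl, h0⟩
      | tail _ he ih =>
        obtain ⟨c, hc, rfl⟩ := ih
        obtain ⟨c', hs, h⟩ := (activeOn_iff hx).1 he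
        exact ⟨c', hc.tail hs, h⟩
    obtain ⟨c, hc, rfl⟩ := this
    exact ⟨c, hc, ha⟩
  · rintro ⟨c, hc, ha⟩
    refine ⟨toVertex hx c, ?_, ha⟩
    clear ha
    induction hc with
    | refl => exact .refl
    | tail _ hs ih => exact ih.tail ((activeOn_iff hx).2 ⟨_, hs, rfl⟩)

/-- With `v` vertices there are `v * (v + 1)` edges including those to `none`. Their blocks have a
fixed length, and activity of an edge depends on the input length and the cell scanned in its
source, so the template works for all inputs up to length `R`. -/
theorem exists_template (M : TwoNFA A) (R : ℕ) :
    ∃ (τ : Type) (T : List τ) (κ : τ → ℕ) (φ : τ → ℕ → Option (Marked A) → Instr),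
      (T.length ≤ let v := Nat.card M.State * (R + 2); v * (v + 1) * (2 * v + 3)) ∧
      ∀ x : List A, x.length ≤ R →
        (universal.clocked.Accepts (fill T κ φ x) ↔ M.Accepts x) := by
  classical
  have := M.finite_state
  have hV : Nat.card (M.Vertex R) = Nat.card M.State * (R + 2) := by
    rw [Nat.card_prod, Nat.card_fin]
  have hpos : 0 < Nat.card M.State := Nat.card_pos_iff.2 ⟨⟨M.start⟩, inferInstance⟩
  obtain ⟨v, hv⟩ : ∃ v, v = Nat.card M.State * (R + 2) := ⟨_, rfl⟩
  rw [← hv] at hV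
  have hv2 : 1 < v := by
    rw [hv]
    nlinarith
  obtain ⟨w, hw⟩ : ∃ w, w = Nat.clog 2 v := ⟨_, rfl⟩
  -- Minimality of the label width is needed below, so that the clock leaves enough space.
  have hw1 : 2 ^ (w - 1) < v := hw ▸ Nat.pow_pred_clog_lt_self one_lt_two hv2
  have hwv : w ≤ v := by
    have : w - 1 < 2 ^ (w - 1) := Nat.lt_two_pow_self
    omega
  obtain ⟨lab, h0, hz, hinj⟩ := exists_label (V := M.Vertex R) (M.start, 0) (w := w)
    (by rw [hV, hw]; exact Nat.le_pow_clog one_lt_two v)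
  let E := M.Vertex R × Option (M.Vertex R)
  obtain ⟨es, hes, hlen⟩ : ∃ l : List E, (∀ e, e ∈ l) ∧ l.length = v * (v + 1) := by
    have := Fintype.ofFinite E
    refine ⟨Finset.univ.toList, by simp, ?_⟩
    rw [Finset.length_toList, Finset.card_univ, ← Nat.card_eq_fintype_card, Nat.card_prod,
      Finite.card_option, hV]
  let T : List (Instr ⊕ E) := es.flatMap fun e =>
    Sum.inr e :: (universal.body lab w e ++ [universal.last e]).map Sum.inl
  let κ : Instr ⊕ E → ℕ := Sum.elim (fun _ => 0) fun e => e.1.2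
  let φ : Instr ⊕ E → ℕ → Option (Marked A) → Instr := fun t n s =>
    t.elim id fun e => if M.Active R e n s then .enter else .skip
  -- Each block has one entry letter, `w` comparisons, `w + 1` write instructions and one last
  -- letter.
  have hT : T.length = v * (v + 1) * (2 * w + 3) := by
    have : ∀ e : E, (Sum.inr e :: (universal.body lab w e ++ [universal.last e]).map Sum.inl :
        List (Instr ⊕ E)).length = 2 * w + 3 := fun e => by
      simp only [List.length_cons, List.length_map, List.length_append, universal.body,
        universal.length_cmps, universal.length_puts, List.length_nil]
      omega
    simp only [T, List.length_flatMap, this, List.map_const', List.sum_replicate, hlen,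
      smul_eq_mul]
  refine ⟨_, T, κ, φ, ?_, fun x hx => ?_⟩
  · simp only [← hv, hT]
    exact Nat.mul_le_mul_left _ (by omega)
  · have hfill : fill T κ φ x = es.flatMap (universal.block lab w (M.ActiveOn R x)) := by
      simp only [fill, T, List.map_flatMap]
      refine List.flatMap_congr fun e _ => ?_
      simp only [universal.block, List.map_cons, List.map_map, κ, φ, Sum.elim_inr, ActiveOn]
      congr 1
      exact List.map_id _
    -- The string has at least `v > 2 ^ (w - 1)` letters, so the binary counter for its length has
    -- at least `w` digits and a label fits.
    have hS : w ≤ NTM.clocked.bound (fill T κ φ x) := by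
      have h1 := NTM.clocked.lt_two_pow_bound (fill T κ φ x)
      rw [length_fill, hT] at h1
      have h2 : v ≤ v * (v + 1) * (2 * w + 3) := by
        rw [mul_assoc]
        exact Nat.le_mul_of_pos_right v (by positivity)
      have := (Nat.pow_lt_pow_iff_right one_lt_two).1 ((hw1.trans_le h2).trans h1)
      omega
    rw [NTM.clocked.accepts_iff, ← reach_iff_accepts hx]
    exact ⟨universal.reach_of_acceptsIn hS h0 hz hinj hfill,
      fun ⟨u, hu, ha⟩ => universal.acceptsIn_of_reach hS h0 hz hinj hes hfill hu ha⟩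

end TwoNFA

/-- If `NL ⊆ L/poly` then `2N/poly ⊆ 2D`. -/
theorem TwoNPoly_subset_TwoD (H : NL ⊆ LPoly) : TwoNPoly ⊆ TwoD := by
  rintro F ⟨⟨p, M, hM⟩, r, hr⟩
  have := F.finite_alph
  let P : DecisionProblem := ⟨Instr, inferInstance, ⟨.skip⟩, {y | universal.clocked.Accepts y}⟩
  have hP : P ∈ NL := ⟨universal.clocked, NTM.clocked.logSpace _, fun _ => Iff.rfl⟩
  obtain ⟨B, _, _, D, h, pa, hpa, ⟨a, b, hS⟩, hyes, hno⟩ := H hP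
  have := D.finite_state
  have := D.finite_work
  choose τ T κ φ hT hacc using fun n => (M n).exists_template (r.eval n)
  have hTp : PolyBounded fun n => (T n).length := by
    have hv : PolyBounded fun n => p.eval n * (r.eval n + 2) :=
      (PolyBounded.eval p).mul ((PolyBounded.eval r).add (.const 2))
    refine ((hv.mul (hv.add (.const 1))).mul (((PolyBounded.const 2).mul hv).add (.const 3))).mono
      fun n => (hT n).trans ?_
    have hle := (hM n).1
    simp only
    gcongr
  obtain ⟨q, hq⟩ : PolyBounded fun n =>
      Nat.card D.State * (((T n).length + 2) * (((h (T n).length).length + 2) *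
        Nat.card (Store D.Work (a * Nat.log 2 (T n).length + b)))) *
      ((r.eval n + 2) * Nat.card (Option (Marked F.Alph))) :=
    ((PolyBounded.const _).mul ((hTp.add (.const 2)).mul
      (((PolyBounded.comp ⟨pa, hpa⟩ hTp).add (.const 2)).mul
        ((Store.polyBounded_card D.Work a b).comp hTp)))).mul
      (((PolyBounded.eval r).add (.const 2)).mul (.const _))
  -- The computed strings for all `x` have length `(T n).length`, so advice and space bound depend
  -- on `n` only.
  have hrun : ∀ n (x : List F.Alph) t, (D.run (fill (T n) (κ n) (φ n) x) (h (T n).length) t).workPos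
      ≤ a * Nat.log 2 (T n).length + b := fun n x t => by
    have := hS (fill (T n) (κ n) (φ n) x) t
    rwa [length_fill] at this
  refine ⟨q, fun n => sweep.automaton D (h (T n).length) (a * Nat.log 2 (T n).length + b)
    (r.eval n) (T n) (κ n) (φ n), fun n => ⟨?_, fun x hx => ?_, fun x hx => ?_⟩⟩
  · rw [sweep.card_automaton]
    exact hq n
  · have hlen := hr n x (.inl hx)
    have := hyes _ ((hacc n x hlen).2 ((hM n).2.1 x hx))
    rw [length_fill] at this
    exact sweep.accepts hlen (hrun n x) this
  · have hlen := hr n x (.inr hx)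
    have := hno _ fun h => (hM n).2.2 x hx ((hacc n x hlen).1 h)
    rw [length_fill] at this
    exact sweep.rejects hlen (hrun n x) this

end StateComplexity

theorem corollary4 :
    StateComplexity.TwoNPoly ⊆ StateComplexity.TwoD ↔
      StateComplexity.NL ⊆ StateComplexity.LPoly :=
  ⟨StateComplexity.NL_subset_LPoly, StateComplexity.TwoNPoly_subset_TwoD⟩
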